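/- Let $\Theta\subseteq(0,\infty)$ have non-empty interior. For $\vartheta\in\Theta$ let $X_t=\sum_{i=1}^{N_t}\varepsilon_i$, $t\ge 0$, where $(N_t)$ is a homogeneous Poisson process with intensity $\vartheta$ and, independently of it, the $\varepsilon_i$ are independent with $\mathbb P_\vartheta(\varepsilon_i=1)=\mathbb P_\vartheta(\varepsilon_i=-1)=\tfrac12$. For $0<\Delta\le T$ let $\mathbb P_\vartheta^{T,\Delta}$ be the law of $(X_\Delta,X_{2\Delta},\dots,X_{\lfloor T/\Delta\rfloor\Delta})$ on $\mathbb Z^{\lfloor T/\Delta\rfloor}$. A family of experiments $(\{Q_\vartheta^{T},\vartheta\in\Theta\})_{T>0}$ is LAN at $\vartheta\in\Theta$ with information (normalisation) $I_T>0$ if there are statistics $\xi_T$, not depending on $v$, with $\xi_T\to\mathcal N(0,1)$ in distribution under $Q^T_\vartheta$ as $T\to\infty$, and for every $v\in\mathbb R$ there are remainders $r_T=r_T(v)\to0$ in probability under $Q^T_\vartheta$ as $T\to\infty$, such that for every $T>0$ with $\vartheta+vI_T^{-1/2}\in\Theta$ one has $Q^T_{\vartheta+vI_T^{-1/2}}\ll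 Q^T_\vartheta$ and, $Q^T_\vartheta$-almost surely, $$\frac{dQ^T_{\vartheta+vI_T^{-1/2}}}{dQ^T_\vartheta}=\exp\big(v\,\xi_T-\tfrac12v^2+r_T\big).$$ For $T,\Delta>0$ put $$I_{T,\Delta}(\vartheta)=T\Delta\;\mathbb E_\vartheta\Big[\Big(\frac{\mathcal I_{|X_\Delta|+1}(\vartheta\Delta)}{\mathcal I_{|X_\Delta|}(\vartheta\Delta)}+\frac{|X_\Delta|}{\vartheta\Delta}-1\Big)^2\Big],\qquad \mathcal I_\nu(x)=\sum_{m\ge0}\frac{(x/2)^{2m+\nu}}{m!\,(\nu+m)!}.$$ Theorem 2 (the microscopic case). Let $0<\Delta_T\le T$ for all $T>0$ and $\Delta_T\to0$ as $T\to\infty$. Then for every $\vartheta\in\Theta$: (i) the family $(\{\mathbb P_\vartheta^{T,\Delta_T},\vartheta\in\Theta\})_{T>0}$ is LAN at $\vartheta$ with information $I_{T,\Delta_T}(\vartheta)$; (ii) $I_{T,\Delta_T}(\vartheta)\sim T/\vartheta$ as $T\to\infty$, that is, the ratio tends to $1$; (iii) for every $T>0$, $\lim_{\Delta\to0^+}I_{T,\Delta}(\vartheta)=T/\vartheta$;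 (iv) $T/\vartheta$ is the information obtained when the jump times of $N$ are observed: the family of experiments generated by observing the path $(N_t)_{0\le t\le T}$ is LAN at $\vartheta$ with information $T/\vartheta$. -/

import Mathlib

open MeasureTheory ProbabilityTheory Filter Topology Asymptotics
open scoped NNReal ENNReal

noncomputable section

namespace AcrossScales

/-- `N` is a homogeneous Poisson process with intensity `ϑ` under `P`: it starts at `0`, has
independent increments, `N t - N s` has the Poisson law of mean `ϑ (t - s)`, and almost every path
is nondecreasing and right-continuous. (Increments are taken in `ℤ`, so nothing is truncated.) -/
structure IsPoissonProcess {Ω : Type*} [MeasurableSpace Ω] (P : Measure Ω) (ϑ : ℝ)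
    (N : ℝ≥0 → Ω → ℕ) : Prop where
  measurable : ∀ t, Measurable (N t)
  start_zero : ∀ᵐ ω ∂P, N 0 ω = 0
  indep_increments : HasIndepIncrements (fun (t : ℝ≥0) (ω : Ω) => (N t ω : ℤ)) P
  increment_law : ∀ s t : ℝ≥0, s ≤ t →
    HasLaw (fun ω => (N t ω : ℤ) - (N s ω : ℤ))
      ((poissonMeasure (ϑ.toNNReal * (t - s))).map (fun n : ℕ => (n : ℤ))) P
  mono : ∀ᵐ ω ∂P, Monotone (fun t => N t ω)
  right_continuous : ∀ᵐ ω ∂P, ∀ t, ContinuousWithinAt (fun s => N s ω) (Set.Ici t) t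

/-- The ingredients of the compound Poisson process with intensity `ϑ` and symmetric Bernoulli
jumps: a Poisson process `N` of intensity `ϑ`, and, independent of it, independent signs `ε i`
with `P (ε i = 1) = P (ε i = -1) = 1 / 2`. -/
structure IsModel {Ω : Type*} [MeasurableSpace Ω] (P : Measure Ω) (ϑ : ℝ)
    (N : ℝ≥0 → Ω → ℕ) (ε : ℕ → Ω → ℤ) : Prop where
  isProbabilityMeasure : IsProbabilityMeasure P
  poisson : IsPoissonProcess P ϑ N
  measurable_sign : ∀ i, Measurable (ε i)
  sign_pos : ∀ i, P {ω | ε i ω = 1} = 1 / 2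
  sign_neg : ∀ i, P {ω | ε i ω = -1} = 1 / 2
  sign_indep : iIndepFun ε P
  indep : IndepFun (fun ω i => ε i ω) (fun ω t => N t ω) P

/-- The compound process `X t = ∑ ε i` over the first `N t` indices, started at `0`. -/
def compound {Ω : Type*} (N : ℝ≥0 → Ω → ℕ) (ε : ℕ → Ω → ℤ) (t : ℝ≥0) (ω : Ω) : ℤ :=
  ∑ i ∈ Finset.range (N t ω), ε i ω

/-- The law of the discrete observation `(X_Δ, X_{2Δ}, …, X_{nΔ})`, where `n = ⌊T / Δ⌋`. -/
def observationLaw {Ω : Type*} [MeasurableSpace Ω] (P : Measure Ω) (X : ℝ≥0 → Ω → ℤ) (T Δ : ℝ) :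
    Measure (Fin ⌊T / Δ⌋₊ → ℤ) :=
  P.map (fun ω i => X ((((i : ℕ) + 1 : ℝ) * Δ).toNNReal) ω)

/-- The law of the whole path `(N t)`, `0 ≤ t ≤ T`, i.e. of the jump times up to time `T`. -/
def pathLaw {Ω : Type*} [MeasurableSpace Ω] (P : Measure Ω) (N : ℝ≥0 → Ω → ℕ) (T : ℝ) :
    Measure ({t : ℝ≥0 // (t : ℝ) ≤ T} → ℕ) :=
  P.map (fun ω t => N t ω)

/-- Local asymptotic normality, at the point `ϑ`, of the experiments `(Q T ϑ')`, `ϑ' ∈ Θ`, as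
`T → ∞`, with normalisation `I T > 0`: there are statistics `ξ T` converging in law to `N(0,1)`
under `Q T ϑ` and, for every real `v`, remainders `r v T` converging to `0` in probability under
`Q T ϑ`, such that whenever `ϑ + v * (I T) ^ (-1/2) ∈ Θ` the likelihood ratio between this
parameter and `ϑ` is `exp (v ξ - v² / 2 + r)`. -/
def IsLAN {𝓧 : ℝ → Type*} [∀ T, MeasurableSpace (𝓧 T)] (Q : (T : ℝ) → ℝ → Measure (𝓧 T))
    (Θ : Set ℝ) (ϑ : ℝ) (I : ℝ → ℝ) : Prop :=
  (∀ T, 0 < T → 0 < I T) ∧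
  ∃ _ : ∀ T, IsProbabilityMeasure (Q T ϑ),
  ∃ ξ : (T : ℝ) → 𝓧 T → ℝ,
    (∀ T, Measurable (ξ T)) ∧
    TendstoInDistribution ξ atTop (id : ℝ → ℝ) (fun T => Q T ϑ) (gaussianReal 0 1) ∧
    ∀ v : ℝ, ∃ r : (T : ℝ) → 𝓧 T → ℝ,
      (∀ T, Measurable (r T)) ∧
      (∀ T, 0 < T → ϑ + v / √(I T) ∈ Θ →
        Q T (ϑ + v / √(I T)) ≪ Q T ϑ ∧
        ∀ᵐ x ∂(Q T ϑ), ((Q T (ϑ + v / √(I T))).rnDeriv (Q T ϑ) x).toReal =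
          Real.exp (v * ξ T x - v ^ 2 / 2 + r T x)) ∧
      ∀ δ : ℝ, 0 < δ → Tendsto (fun T => Q T ϑ {x | δ ≤ |r T x|}) atTop (𝓝 0)

/-- The modified Bessel function of the first kind, of order `ν ∈ ℕ`. -/
def besselI (ν : ℕ) (x : ℝ) : ℝ :=
  ∑' m : ℕ, (x / 2) ^ (2 * m + ν) / ((m.factorial : ℝ) * ((ν + m).factorial : ℝ))

/-- `h_Δ(ϑ, k) = I_{|k|+1}(ϑΔ) / I_{|k|}(ϑΔ)`. -/
def besselRatio (Δ ϑ : ℝ) (k : ℤ) : ℝ :=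
  besselI (k.natAbs + 1) (ϑ * Δ) / besselI k.natAbs (ϑ * Δ)

/-- `I_{T,Δ}(ϑ) = T Δ E[(h_Δ(ϑ, X_Δ) + (ϑΔ)⁻¹ |X_Δ| - 1)²]`. -/
def information {Ω : Type*} [MeasurableSpace Ω] (P : Measure Ω) (X : ℝ≥0 → Ω → ℤ) (ϑ T Δ : ℝ) :
    ℝ :=
  T * Δ * ∫ ω, (besselRatio Δ ϑ (X Δ.toNNReal ω) +
    (ϑ * Δ)⁻¹ * |((X Δ.toNNReal ω : ℤ) : ℝ)| - 1) ^ 2 ∂P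

end AcrossScales

end

/-!
The increments of `X` over the observation grid are independent symmetric Skellam variables, with
point probabilities `e^{-λ} I_{|k|}(λ)` for `λ = ϑ Δ`. When `λ → 0` only the outcomes `k = 0, ±1`
matter to first order in `λ`, and there the score is close to `|k| / ϑ - Δ`: an observer of the
increments sees as much as an observer of the jump times, and the information per unit of time tends
to that of the Poisson process, namely `1 / ϑ`.

Both experiments then satisfy the same criterion. With `u = v / √I_T`, the log-likelihood ratio is
`u S + A (log (1 + u / ϑ) - u / ϑ)` up to a remainder of order `u² T Δ`, where `S` is the score and
`A` stands for the number of jumps: `∑ |k_j|` on the grid, and `N_T` for the path, where there is no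
remainder. Since `A / T → ϑ` in mean square and `I_T ~ T / ϑ`, the second summand tends to
`-v² / 2`. The score on the grid is asymptotically normal because its characteristic function is the
`⌊T / Δ⌋`-th power of one whose deviation from `1` is again governed by the outcomes `k = 0, ±1`.
-/

namespace AcrossScales

section BesselSeries

/-- The entire function `∑ z ^ m / (m! (k + m)!)`, in terms of which
`besselI k x = (x / 2) ^ k * besselSeries k ((x / 2) ^ 2)`. -/
noncomputable def besselSeries (k : ℕ) (z : ℝ) : ℝ :=
  ∑' m : ℕ, z ^ m / ((m.factorial : ℝ) * ((k + m).factorial : ℝ))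

lemma besselI_eq (k : ℕ) (x : ℝ) : besselI k x = (x / 2) ^ k * besselSeries k ((x / 2) ^ 2) := by
  rw [besselI, besselSeries, ← tsum_mul_left]
  refine tsum_congr fun m => ?_
  rw [pow_add, pow_mul]
  ring

lemma norm_besselSeries_term_le (k m : ℕ) (z : ℝ) :
    ‖z ^ m / ((m.factorial : ℝ) * ((k + m).factorial : ℝ))‖ ≤ |z| ^ m / m.factorial := by
  rw [norm_div, norm_pow, norm_mul, RCLike.norm_natCast, RCLike.norm_natCast, Real.norm_eq_abs]
  gcongr
  exact le_mul_of_one_le_right (by positivity) (mod_cast (k + m).factorial_pos)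

lemma summable_besselSeries (k : ℕ) (z : ℝ) :
    Summable fun m : ℕ => z ^ m / ((m.factorial : ℝ) * ((k + m).factorial : ℝ)) :=
  .of_norm_bounded (Real.summable_pow_div_factorial |z|) fun m => norm_besselSeries_term_le k m z

lemma besselSeries_eq_add (k : ℕ) (z : ℝ) :
    besselSeries k z = 1 / (k.factorial : ℝ) +
      ∑' m : ℕ, z ^ (m + 1) / (((m + 1).factorial : ℝ) * ((k + (m + 1)).factorial : ℝ)) := by
  rw [besselSeries, (summable_besselSeries k z).tsum_eq_zero_add]
  simp

lemma hasDerivAt_besselSeries_term (k m : ℕ) (z : ℝ) :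
    HasDerivAt (fun z => z ^ (m + 1) / (((m + 1).factorial : ℝ) * ((k + (m + 1)).factorial : ℝ)))
      (z ^ m / ((m.factorial : ℝ) * ((k + 1 + m).factorial : ℝ))) z := by
  convert! (hasDerivAt_pow (m + 1) z).div_const _ using 1
  rw [Nat.factorial_succ m, show k + (m + 1) = k + 1 + m by ring, Nat.add_sub_cancel]
  push_cast
  field_simp

lemma hasDerivAt_besselSeries (k : ℕ) (z : ℝ) :
    HasDerivAt (besselSeries k) (besselSeries (k + 1) z) z := by
  rw [funext (besselSeries_eq_add k)]
  refine .const_add _ <| hasDerivAt_tsum_of_isPreconnected (y₀ := z)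
    (Real.summable_pow_div_factorial (|z| + 1)) Metric.isOpen_ball
    (convex_ball 0 (|z| + 1)).isPreconnected
    (fun m y _ => hasDerivAt_besselSeries_term k m y) (fun m y hy => ?_) (by simp)
    ((summable_nat_add_iff 1).mpr (summable_besselSeries k z)) (by simp)
  refine (norm_besselSeries_term_le (k + 1) m y).trans ?_
  gcongr
  exact (mem_ball_zero_iff.mp hy).le

lemma one_div_factorial_le_besselSeries {k : ℕ} {z : ℝ} (hz : 0 ≤ z) :
    1 / (k.factorial : ℝ) ≤ besselSeries k z := by
  rw [besselSeries_eq_add]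
  exact le_add_of_nonneg_right (tsum_nonneg fun m => by positivity)

lemma besselSeries_pos {k : ℕ} {z : ℝ} (hz : 0 ≤ z) : 0 < besselSeries k z :=
  lt_of_lt_of_le (by positivity) (one_div_factorial_le_besselSeries hz)

lemma besselSeries_le {k : ℕ} {z : ℝ} (hz : 0 ≤ z) :
    besselSeries k z ≤ Real.exp z / k.factorial := by
  rw [Real.exp_eq_exp_ℝ, NormedSpace.exp_eq_tsum_div, ← tsum_div_const, besselSeries]
  refine (summable_besselSeries k z).tsum_le_tsum (fun m => ?_)
    ((Real.summable_pow_div_factorial z).div_const _)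
  rw [div_div]
  gcongr
  omega

lemma besselSeries_succ_le {k : ℕ} {z : ℝ} (hz : 0 ≤ z) :
    besselSeries (k + 1) z ≤ besselSeries k z := by
  refine (summable_besselSeries (k + 1) z).tsum_le_tsum (fun m => ?_) (summable_besselSeries k z)
  gcongr
  omega

lemma besselSeries_recurrence (k : ℕ) (z : ℝ) :
    besselSeries k z - z * besselSeries (k + 2) z = (k + 1) * besselSeries (k + 1) z := by
  rw [besselSeries_eq_add k, besselSeries_eq_add (k + 1), besselSeries, ← tsum_mul_left,
    mul_add, ← tsum_mul_left, add_sub_assoc, ← Summable.tsum_sub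
      ((summable_nat_add_iff 1).mpr (summable_besselSeries k z))
      ((summable_besselSeries (k + 2) z).mul_left z)]
  congr 1
  · rw [Nat.factorial_succ]; push_cast; field_simp
  · refine tsum_congr fun m => ?_
    rw [show k + 2 + m = (k + m + 1) + 1 by ring, show k + 1 + (m + 1) = (k + m + 1) + 1 by ring,
      show k + (m + 1) = k + m + 1 by ring, Nat.factorial_succ (k + m + 1), Nat.factorial_succ m]
    push_cast
    field_simp
    ring

/-- The logarithmic derivative of `besselSeries k`; see `besselRatio_eq` for its relation to the
Bessel quotient in the score. -/
noncomputable def besselSlope (k : ℕ) (z : ℝ) : ℝ := besselSeries (k + 1) z / besselSeries k z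

lemma besselSlope_nonneg {k : ℕ} {z : ℝ} (hz : 0 ≤ z) : 0 ≤ besselSlope k z :=
  div_nonneg (besselSeries_pos hz).le (besselSeries_pos hz).le

lemma besselSlope_le_one {k : ℕ} {z : ℝ} (hz : 0 ≤ z) : besselSlope k z ≤ 1 :=
  (div_le_one (besselSeries_pos hz)).mpr (besselSeries_succ_le hz)

lemma hasDerivAt_besselSlope {k : ℕ} {z : ℝ} (hz : 0 ≤ z) :
    HasDerivAt (besselSlope k)
      (besselSlope (k + 1) z * besselSlope k z - besselSlope k z ^ 2) z := by
  have h₀ := (besselSeries_pos (k := k) hz).ne'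
  have h₁ := (besselSeries_pos (k := k + 1) hz).ne'
  convert! (hasDerivAt_besselSeries (k + 1) z).div (hasDerivAt_besselSeries k z) h₀ using 1
  simp only [besselSlope]
  field_simp

lemma abs_besselSlope_sub_le {k : ℕ} {z z' : ℝ} (hz : 0 ≤ z) (hz' : 0 ≤ z') :
    |besselSlope k z' - besselSlope k z| ≤ |z' - z| := by
  have hbound : ∀ x ∈ Set.Ici (0 : ℝ),
      ‖besselSlope (k + 1) x * besselSlope k x - besselSlope k x ^ 2‖ ≤ 1 := fun x hx => by
    have := besselSlope_nonneg (k := k) hx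
    have := besselSlope_le_one (k := k) hx
    have := besselSlope_nonneg (k := k + 1) hx
    have := besselSlope_le_one (k := k + 1) hx
    rw [Real.norm_eq_abs, abs_le]
    constructor <;> nlinarith
  simpa using (convex_Ici (0 : ℝ)).norm_image_sub_le_of_norm_hasDerivWithin_le
    (fun x hx => (hasDerivAt_besselSlope hx).hasDerivWithinAt) hbound hz hz'

lemma abs_log_besselSeries_sub_le {k : ℕ} {z z' : ℝ} (hz : 0 ≤ z) (hz' : 0 ≤ z') :
    |Real.log (besselSeries k z') - Real.log (besselSeries k z) - (z' - z) * besselSlope k z|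
      ≤ (z' - z) ^ 2 := by
  have hnonneg : ∀ x ∈ Set.uIcc z z', 0 ≤ x := fun x hx => (le_min hz hz').trans hx.1
  have hderiv : ∀ x ∈ Set.uIcc z z', HasDerivWithinAt
      (fun x => Real.log (besselSeries k x) - x * besselSlope k z)
      (besselSlope k x - besselSlope k z) (Set.uIcc z z') x := fun x hx => by
    have hlog := (hasDerivAt_besselSeries k x).log (besselSeries_pos (hnonneg x hx)).ne'
    convert! (hlog.sub ((hasDerivAt_id x).mul_const (besselSlope k z))).hasDerivWithinAt using 1
    simp [besselSlope]
  have := (convex_uIcc z z').norm_image_sub_le_of_norm_hasDerivWithin_le (C := |z' - z|) hderiv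
    (fun x hx => (abs_besselSlope_sub_le hz (hnonneg x hx)).trans (Set.abs_sub_left_of_mem_uIcc hx))
    Set.left_mem_uIcc Set.right_mem_uIcc
  rw [Real.norm_eq_abs, Real.norm_eq_abs, abs_mul_abs_self, ← sq] at this
  convert! this using 2
  ring

lemma besselI_pos {x : ℝ} (hx : 0 < x) (k : ℕ) : 0 < besselI k x := by
  rw [besselI_eq]
  exact mul_pos (by positivity) (besselSeries_pos (sq_nonneg _))

lemma besselI_recurrence {x : ℝ} (hx : x ≠ 0) (k : ℕ) :
    besselI k x - besselI (k + 2) x = 2 * (k + 1) / x * besselI (k + 1) x := by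
  rw [besselI_eq, besselI_eq, besselI_eq]
  calc _ = (x / 2) ^ k * (besselSeries k ((x / 2) ^ 2) -
        (x / 2) ^ 2 * besselSeries (k + 2) ((x / 2) ^ 2)) := by ring
    _ = _ := by rw [besselSeries_recurrence]; field_simp; ring

lemma besselI_natAbs_recurrence {x : ℝ} (hx : x ≠ 0) (k : ℤ) :
    besselI (k.natAbs + 1) x + |(k : ℝ)| / x * besselI k.natAbs x =
      (besselI (k + 1).natAbs x + besselI (k - 1).natAbs x) / 2 := by
  have hsucc (j : ℕ) : besselI (j + 2) x + ((j + 1 : ℕ) : ℝ) / x * besselI (j + 1) x =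
      (besselI (j + 2) x + besselI j x) / 2 := by
    have := besselI_recurrence hx j
    rw [mul_div_assoc, mul_assoc] at this
    push_cast
    linarith
  obtain ⟨_ | j, rfl | rfl⟩ := k.eq_nat_or_neg
  · simp
  · simp
  · rw [show ((j + 1 : ℕ) + 1 : ℤ).natAbs = j + 2 by omega,
      show ((j + 1 : ℕ) - 1 : ℤ).natAbs = j by omega, Int.natAbs_natCast, ← hsucc j]
    simp only [Int.cast_natCast, Nat.abs_cast]
  · rw [show (-(j + 1 : ℕ) + 1 : ℤ).natAbs = j by omega,
      show (-(j + 1 : ℕ) - 1 : ℤ).natAbs = j + 2 by omega, Int.natAbs_neg, Int.natAbs_natCast,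
      add_comm (besselI j x), ← hsucc j]
    simp only [Int.cast_neg, Int.cast_natCast, abs_neg, Nat.abs_cast]

lemma besselRatio_eq {Δ ϑ : ℝ} (h : ϑ * Δ ≠ 0) (k : ℤ) : besselRatio Δ ϑ k =
    ϑ * Δ / 2 * besselSlope k.natAbs ((ϑ * Δ / 2) ^ 2) := by
  have := besselSeries_pos (k := k.natAbs) (sq_nonneg (ϑ * Δ / 2))
  rw [besselRatio, besselI_eq, besselI_eq, besselSlope]
  field_simp
  ring

end BesselSeries

section Skellam

/-- The probability that a simple symmetric random walk started at `0` sits at `k` after `n`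
steps. -/
noncomputable def walkProb : ℕ → ℤ → ℝ
  | 0, k => if k = 0 then 1 else 0
  | n + 1, k => (walkProb n (k - 1) + walkProb n (k + 1)) / 2

lemma walkProb_zero (k : ℤ) : walkProb 0 k = if k = 0 then 1 else 0 := rfl

lemma walkProb_succ (n : ℕ) (k : ℤ) :
    walkProb (n + 1) k = (walkProb n (k - 1) + walkProb n (k + 1)) / 2 := rfl

lemma walkProb_neg (n : ℕ) (k : ℤ) : walkProb n (-k) = walkProb n k := by
  induction n generalizing k with
  | zero => simp only [walkProb_zero, neg_eq_zero]
  | succ n ih =>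
    rw [walkProb_succ, walkProb_succ, ← ih (k - 1), ← ih (k + 1), add_comm, neg_sub', neg_add',
      sub_neg_eq_add]

lemma walkProb_eq_zero {n : ℕ} {k : ℤ} (h : ∀ j : ℕ, k ≠ n - 2 * j) : walkProb n k = 0 := by
  induction n generalizing k with
  | zero => simpa [walkProb_zero] using h 0
  | succ n ih =>
    rw [walkProb_succ, ih fun j hj => h j (by push_cast; omega),
      ih fun j hj => h (j + 1) (by push_cast; omega), add_zero, zero_div]

lemma walkProb_sub_two_mul (n j : ℕ) : walkProb n (n - 2 * j) = (n.choose j : ℝ) / 2 ^ n := by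
  induction n generalizing j with
  | zero => rcases j with _ | j <;> simp [walkProb_zero]; omega
  | succ n ih =>
    rw [walkProb_succ]
    rcases j with _ | j
    · have hright : walkProb n ((n + 1 : ℕ) - 2 * (0 : ℕ) + 1) = 0 :=
        walkProb_eq_zero fun j => by push_cast; omega
      have hleft := ih 0
      rw [hright, show ((n + 1 : ℕ) : ℤ) - 2 * (0 : ℕ) - 1 = n - 2 * (0 : ℕ) by push_cast; ring,
        hleft, pow_succ, Nat.choose_zero_right, Nat.choose_zero_right]
      ring
    · rw [show ((n + 1 : ℕ) : ℤ) - 2 * (j + 1 : ℕ) - 1 = n - 2 * (j + 1 : ℕ) by push_cast; ring,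
        show ((n + 1 : ℕ) : ℤ) - 2 * (j + 1 : ℕ) + 1 = n - 2 * j by push_cast; ring, ih, ih,
        Nat.choose_succ_succ, pow_succ]
      push_cast
      ring

/-- The probability that the difference of two independent Poisson variables of mean `lam / 2`
equals `k`; equivalently, the probability that a symmetric compound Poisson sum of `±1` with a mean
number `lam` of terms equals `k`. -/
noncomputable def skellamProb (lam : ℝ) (k : ℤ) : ℝ := Real.exp (-lam) * besselI k.natAbs lam

lemma skellamProb_neg (lam : ℝ) (k : ℤ) : skellamProb lam (-k) = skellamProb lam k := by
  rw [skellamProb, skellamProb, Int.natAbs_neg]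

lemma skellamProb_eq (lam : ℝ) (k : ℤ) : skellamProb lam k =
    Real.exp (-lam) * ((lam / 2) ^ k.natAbs * besselSeries k.natAbs ((lam / 2) ^ 2)) := by
  rw [skellamProb, besselI_eq]

lemma skellamProb_pos {lam : ℝ} (h : 0 < lam) (k : ℤ) : 0 < skellamProb lam k :=
  mul_pos (Real.exp_pos _) (besselI_pos h _)

lemma log_skellamProb {lam : ℝ} (h : 0 < lam) (k : ℤ) : Real.log (skellamProb lam k) =
    -lam + k.natAbs * Real.log (lam / 2) +
      Real.log (besselSeries k.natAbs ((lam / 2) ^ 2)) := by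
  have := besselSeries_pos (k := k.natAbs) (sq_nonneg (lam / 2))
  rw [skellamProb_eq, Real.log_mul (by positivity) (by positivity),
    Real.log_mul (by positivity) (by positivity), Real.log_exp, Real.log_pow, add_assoc]

lemma skellamProb_le {lam : ℝ} (h : 0 ≤ lam) (k : ℤ) : skellamProb lam k ≤
    Real.exp ((lam / 2) ^ 2 - lam) * ((lam / 2) ^ k.natAbs / k.natAbs.factorial) := by
  have := besselSeries_le (k := k.natAbs) (sq_nonneg (lam / 2))
  calc skellamProb lam k ≤ Real.exp (-lam) * ((lam / 2) ^ k.natAbs *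
        (Real.exp ((lam / 2) ^ 2) / k.natAbs.factorial)) := by rw [skellamProb_eq]; gcongr
    _ = _ := by rw [sub_eq_neg_add, Real.exp_add]; ring

lemma tsum_poisson_mul_walkProb_natCast (lam : ℝ) (k : ℕ) :
    ∑' n : ℕ, (Real.exp (-lam) * lam ^ n / n.factorial) * walkProb n k = skellamProb lam k := by
  have hinj : Function.Injective (fun m : ℕ => 2 * m + k) := fun a b h => by simpa using h
  have hsupp : Function.support
      (fun n : ℕ => (Real.exp (-lam) * lam ^ n / n.factorial) * walkProb n k) ⊆
      Set.range fun m : ℕ => 2 * m + k := fun n hn => by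
    by_contra hrange
    exact hn (mul_eq_zero_of_right _ (walkProb_eq_zero fun j hj => hrange ⟨j, by grind⟩))
  rw [← hinj.tsum_eq hsupp, skellamProb, besselI, ← tsum_mul_left]
  refine tsum_congr fun m => ?_
  have hwalk : walkProb (2 * m + k) k = ((2 * m + k).choose m : ℝ) / 2 ^ (2 * m + k) := by
    rw [← walkProb_sub_two_mul]
    congr 1
    push_cast
    ring
  have hchoose : ((2 * m + k).choose m : ℝ) =
      (2 * m + k).factorial / (m.factorial * (k + m).factorial) := by
    rw [Nat.cast_choose ℝ (by omega), show 2 * m + k - m = k + m by omega]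
  rw [hwalk, hchoose, Int.natAbs_natCast, div_pow]
  field_simp

lemma integral_walkProb_poissonMeasure (lam : ℝ≥0) (k : ℤ) :
    ∫ n, walkProb n k ∂poissonMeasure lam = skellamProb lam k := by
  simp_rw [integral_poissonMeasure, smul_eq_mul]
  obtain ⟨j, rfl | rfl⟩ := k.eq_nat_or_neg
  · exact tsum_poisson_mul_walkProb_natCast lam j
  · simp_rw [walkProb_neg, skellamProb_neg, tsum_poisson_mul_walkProb_natCast]

/-- The symmetric Skellam law: the law of the difference of two independent Poisson variables of
mean `lam / 2`. It is the law of the increments of the compound process, with `lam = ϑ Δ`. -/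
noncomputable def skellamMeasure (lam : ℝ) : Measure ℤ :=
  ((poissonMeasure (lam / 2).toNNReal).prod (poissonMeasure (lam / 2).toNNReal)).map
    fun p => (p.1 : ℤ) - p.2

instance (lam : ℝ) : IsProbabilityMeasure (skellamMeasure lam) :=
  Measure.isProbabilityMeasure_map .of_discrete

lemma map_neg_skellamMeasure (lam : ℝ) : (skellamMeasure lam).map (-·) = skellamMeasure lam := by
  rw [skellamMeasure, Measure.map_map .of_discrete .of_discrete]
  conv_rhs => rw [← Measure.prod_swap, Measure.map_map .of_discrete .of_discrete]
  exact congrArg (Measure.map · _) (funext fun p => neg_sub (p.1 : ℤ) p.2)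

lemma skellamMeasure_real_singleton_natCast {lam : ℝ} (h : 0 ≤ lam) (k : ℕ) :
    (skellamMeasure lam).real {(k : ℤ)} = skellamProb lam k := by
  set μ := poissonMeasure (lam / 2).toNNReal with hμ
  have hslice (m : ℕ) :
      (fun l : ℕ => (l, m)) ⁻¹' ((fun p : ℕ × ℕ => (p.1 : ℤ) - p.2) ⁻¹' {(k : ℤ)}) = {k + m} := by
    ext l
    simp only [Set.mem_preimage, Set.mem_singleton_iff]
    omega
  have hint : (skellamMeasure lam).real {(k : ℤ)} = ∫ m, μ.real {k + m} ∂μ := by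
    rw [skellamMeasure, map_measureReal_apply .of_discrete .of_discrete, measureReal_def,
      Measure.prod_apply_symm .of_discrete, ← integral_toReal .of_discrete (by simp)]
    simp_rw [hslice, measureReal_def, hμ]
  rw [hint, hμ, integral_poissonMeasure, skellamProb, besselI, ← tsum_mul_left]
  refine tsum_congr fun m => ?_
  rw [poissonMeasure_real_singleton, Real.coe_toNNReal _ (by positivity), Int.natAbs_natCast,
    show -lam = -(lam / 2) + -(lam / 2) by ring, Real.exp_add, smul_eq_mul]
  ring

lemma skellamMeasure_real_singleton {lam : ℝ} (h : 0 ≤ lam) (k : ℤ) :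
    (skellamMeasure lam).real {k} = skellamProb lam k := by
  obtain ⟨j, rfl | rfl⟩ := k.eq_nat_or_neg
  · exact skellamMeasure_real_singleton_natCast h j
  · rw [skellamProb_neg, ← skellamMeasure_real_singleton_natCast h,
      ← map_neg_skellamMeasure, map_measureReal_apply .of_discrete .of_discrete,
      map_neg_skellamMeasure]
    congr 1
    ext l
    simp

end Skellam

section SmallIntensity

variable {E : Type*} [NormedAddCommGroup E]

lemma summable_int_pow_div_factorial (b : ℝ) :
    Summable fun k : ℤ => b ^ k.natAbs / (k.natAbs.factorial : ℝ) :=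
  .of_nat_of_neg (by simpa using Real.summable_pow_div_factorial b)
    (by simpa using Real.summable_pow_div_factorial b)

lemma summable_skellamProb {lam : ℝ} (hlam : 0 ≤ lam) : Summable (skellamProb lam) :=
  .of_nonneg_of_le (fun k => skellamMeasure_real_singleton hlam k ▸ measureReal_nonneg)
    (skellamProb_le hlam) ((summable_int_pow_div_factorial _).mul_left _)

lemma exp_two_mul_natAbs (k : ℤ) : Real.exp (2 * k.natAbs) = Real.exp 2 ^ k.natAbs := by
  rw [mul_comm, Real.exp_nat_mul]

lemma integrable_skellamMeasure {lam : ℝ} (hlam : 0 ≤ lam) {f : ℤ → E} {C : ℝ}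
    (hf : ∀ k, ‖f k‖ ≤ C * Real.exp (2 * k.natAbs)) : Integrable f (skellamMeasure lam) := by
  rw [← Measure.sum_smul_dirac (skellamMeasure lam),
    integrable_sum_dirac_iff fun k => measure_ne_top _ _]
  simp_rw [← measureReal_def]
  refine .of_nonneg_of_le (fun k => by positivity) (fun k => ?_)
    ((summable_int_pow_div_factorial (lam / 2 * Real.exp 2)).mul_left
      (Real.exp ((lam / 2) ^ 2 - lam) * C))
  calc _ ≤ (Real.exp ((lam / 2) ^ 2 - lam) * ((lam / 2) ^ k.natAbs / k.natAbs.factorial)) *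
        (C * Real.exp (2 * k.natAbs)) := by
        gcongr
        · exact (skellamMeasure_real_singleton hlam k).trans_le (skellamProb_le hlam k)
        · exact hf k
    _ = _ := by rw [exp_two_mul_natAbs, mul_pow]; ring

lemma inv_mul_skellamProb {lam : ℝ} (hlam : lam ≠ 0) {k : ℤ} {j : ℕ} (hk : k.natAbs = j + 1) :
    lam⁻¹ * skellamProb lam k =
      Real.exp (-lam) * (lam ^ j / 2 ^ (j + 1) * besselSeries (j + 1) ((lam / 2) ^ 2)) := by
  rw [skellamProb_eq, hk, div_pow, pow_succ lam]
  field_simp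

lemma inv_mul_skellamProb_le {lam : ℝ} (hlam : 0 < lam) (hlam1 : lam ≤ 1) {k : ℤ} (hk : k ≠ 0) :
    lam⁻¹ * skellamProb lam k ≤ (1 / 2) ^ k.natAbs / k.natAbs.factorial := by
  obtain ⟨j, hj⟩ := Nat.exists_eq_succ_of_ne_zero (Int.natAbs_ne_zero.mpr hk)
  rw [inv_mul_le_iff₀ hlam]
  calc skellamProb lam k ≤ 1 * ((lam / 2) ^ k.natAbs / k.natAbs.factorial) := by
        refine (skellamProb_le hlam.le k).trans ?_
        gcongr
        exact Real.exp_le_one_iff.mpr (by nlinarith)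
    _ = lam ^ (j + 1) * ((1 / 2) ^ k.natAbs / k.natAbs.factorial) := by
        rw [hj, Nat.succ_eq_add_one, div_pow, div_pow]; ring
    _ ≤ _ := by gcongr; exact pow_le_of_le_one hlam.le hlam1 j.succ_ne_zero

variable {ι : Type*} {l : Filter ι} {lam : ι → ℝ}

lemma tendsto_besselSeries (hlam : Tendsto lam l (𝓝 0)) (k : ℕ) :
    Tendsto (fun i => besselSeries k ((lam i / 2) ^ 2)) l (𝓝 (1 / (k.factorial : ℝ))) := by
  have hsq : Tendsto (fun i => (lam i / 2) ^ 2) l (𝓝 0) := by simpa using (hlam.div_const 2).pow 2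
  have hzero : besselSeries k 0 = 1 / (k.factorial : ℝ) := by simp [besselSeries_eq_add]
  exact hzero ▸ (hasDerivAt_besselSeries k 0).continuousAt.tendsto.comp hsq

lemma tendsto_exp_neg (hlam : Tendsto lam l (𝓝 0)) : Tendsto (fun i => Real.exp (-lam i)) l (𝓝 1) :=
  Real.exp_zero ▸ neg_zero (G := ℝ) ▸ hlam.neg.rexp

lemma tendsto_skellamProb_zero (hlam : Tendsto lam l (𝓝 0)) :
    Tendsto (fun i => skellamProb (lam i) 0) l (𝓝 1) := by
  simpa [skellamProb_eq] using (tendsto_exp_neg hlam).mul (tendsto_besselSeries hlam 0)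

lemma tendsto_inv_mul_skellamProb (hlam : Tendsto lam l (𝓝[>] 0)) {k : ℤ} (hk : k ≠ 0) :
    Tendsto (fun i => (lam i)⁻¹ * skellamProb (lam i) k) l
      (𝓝 (if k.natAbs = 1 then 1 / 2 else 0)) := by
  obtain ⟨j, hj⟩ := Nat.exists_eq_succ_of_ne_zero (Int.natAbs_ne_zero.mpr hk)
  have hlam0 := hlam.mono_right nhdsWithin_le_nhds
  have hlim : 1 * (0 ^ j / 2 ^ (j + 1) * (1 / ((j + 1).factorial : ℝ))) =
      if k.natAbs = 1 then (1 / 2 : ℝ) else 0 := by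
    rcases j with _ | j <;> simp [hj]
  rw [← hlim]
  refine ((tendsto_exp_neg hlam0).mul
    (((hlam0.pow j).div_const _).mul (tendsto_besselSeries hlam0 (j + 1)))).congr' ?_
  filter_upwards [hlam.eventually self_mem_nhdsWithin] with i hi
  exact (inv_mul_skellamProb (ne_of_gt hi) hj).symm

variable [NormedSpace ℝ E] {f : ι → ℤ → E} {C : ℝ} {a b : E}

lemma tendsto_inv_smul_skellamProb_smul (hlam : Tendsto lam l (𝓝[>] 0))
    (hf : ∀ᶠ i in l, ∀ k, ‖f i k‖ ≤ C * Real.exp (2 * k.natAbs))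
    (h₀ : Tendsto (fun i => (lam i)⁻¹ • f i 0) l (𝓝 0)) (h₁ : Tendsto (fun i => f i 1) l (𝓝 a))
    (h₂ : Tendsto (fun i => f i (-1)) l (𝓝 b)) (k : ℤ) :
    Tendsto (fun i => (lam i)⁻¹ • skellamProb (lam i) k • f i k) l
      (𝓝 (if k = 1 then (1 / 2 : ℝ) • a else if k = -1 then (1 / 2 : ℝ) • b else 0)) := by
  rcases eq_or_ne k 0 with rfl | hk
  · simp_rw [smul_comm (lam _)⁻¹]
    simpa using (tendsto_skellamProb_zero (hlam.mono_right nhdsWithin_le_nhds)).smul h₀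
  have hprob := tendsto_inv_mul_skellamProb hlam hk
  simp_rw [smul_smul]
  split_ifs with hk₁ hk₂
  · subst hk₁; simpa using hprob.smul h₁
  · subst hk₂; simpa using hprob.smul h₂
  · rw [if_neg (by omega)] at hprob
    refine hprob.zero_smul_isBoundedUnder_le
      (isBoundedUnder_of_eventually_le (a := C * Real.exp (2 * k.natAbs)) ?_)
    filter_upwards [hf] with i hi using hi k

lemma norm_inv_smul_skellamProb_smul_le {lam : ℝ} {f : ℤ → E} (hlam : 0 < lam) (hlam1 : lam ≤ 1)
    (hf : ∀ k, ‖f k‖ ≤ C * Real.exp (2 * k.natAbs)) (h₀ : ‖lam⁻¹ • f 0‖ ≤ 1) (k : ℤ) :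
    ‖lam⁻¹ • skellamProb lam k • f k‖ ≤
      C * ((1 / 2 * Real.exp 2) ^ k.natAbs / k.natAbs.factorial) + if k = 0 then 1 else 0 := by
  have hC : 0 ≤ C := by simpa using (norm_nonneg _).trans (hf 0)
  have hnonneg := (skellamProb_pos hlam k).le
  rcases eq_or_ne k 0 with rfl | hk
  · have hle : skellamProb lam 0 ≤ 1 := (skellamProb_le hlam.le 0).trans (by simp; nlinarith)
    rw [smul_comm, norm_smul, Real.norm_of_nonneg hnonneg, if_pos rfl]
    exact (mul_le_one₀ hle (norm_nonneg _) h₀).trans (le_add_of_nonneg_left (by positivity))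
  · rw [smul_smul, norm_smul, Real.norm_of_nonneg (by positivity), if_neg hk, add_zero]
    calc _ ≤ (1 / 2) ^ k.natAbs / k.natAbs.factorial * (C * Real.exp (2 * k.natAbs)) := by
          gcongr
          · exact inv_mul_skellamProb_le hlam hlam1 hk
          · exact hf k
      _ = _ := by rw [exp_two_mul_natAbs, mul_pow]; ring

theorem tendsto_inv_smul_integral_skellamMeasure [CompleteSpace E]
    (hlam : Tendsto lam l (𝓝[>] 0))
    (hf : ∀ᶠ i in l, ∀ k, ‖f i k‖ ≤ C * Real.exp (2 * k.natAbs))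
    (h₀ : Tendsto (fun i => (lam i)⁻¹ • f i 0) l (𝓝 0)) (h₁ : Tendsto (fun i => f i 1) l (𝓝 a))
    (h₂ : Tendsto (fun i => f i (-1)) l (𝓝 b)) :
    Tendsto (fun i => (lam i)⁻¹ • ∫ k, f i k ∂skellamMeasure (lam i)) l
      (𝓝 ((1 / 2 : ℝ) • (a + b))) := by
  have hpos : ∀ᶠ i in l, 0 < lam i := hlam.eventually self_mem_nhdsWithin
  have hle : ∀ᶠ i in l, lam i ≤ 1 :=
    (hlam.mono_right nhdsWithin_le_nhds).eventually (ge_mem_nhds one_pos)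
  have hsummable : Summable fun k : ℤ =>
      C * ((1 / 2 * Real.exp 2) ^ k.natAbs / k.natAbs.factorial) + if k = 0 then (1 : ℝ) else 0 :=
    ((summable_int_pow_div_factorial _).mul_left C).add
      (summable_of_ne_finset_zero (s := {0}) fun k hk => if_neg (by simpa using hk))
  have htsum : ∑' k : ℤ, (if k = 1 then (1 / 2 : ℝ) • a else if k = -1 then (1 / 2 : ℝ) • b else 0)
      = (1 / 2 : ℝ) • (a + b) := by
    rw [tsum_eq_sum (s := {1, -1}) fun k hk => by aesop, Finset.sum_pair (by norm_num), smul_add]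
    simp
  rw [← htsum]
  have hzero : ∀ᶠ i in l, ‖(lam i)⁻¹ • f i 0‖ ≤ 1 :=
    h₀.norm.eventually (ge_mem_nhds (by rw [norm_zero]; exact one_pos))
  refine (tendsto_tsum_of_dominated_convergence hsummable
    (tendsto_inv_smul_skellamProb_smul hlam hf h₀ h₁ h₂) ?_).congr' ?_
  · filter_upwards [hpos, hle, hf, hzero] with i hi hi₁ hfi hi₀
    exact norm_inv_smul_skellamProb_smul_le hi hi₁ hfi hi₀
  · filter_upwards [hpos, hf] with i hi hfi
    rw [integral_countable (integrable_skellamMeasure hi.le hfi), tsum_const_smul'']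
    simp_rw [skellamMeasure_real_singleton hi.le]

end SmallIntensity

section Score

/-- The derivative in `ϑ` of the log-likelihood `log (skellamProb (ϑ * Δ) k)` of one increment. -/
noncomputable def score (Δ ϑ : ℝ) (k : ℤ) : ℝ :=
  Δ * (besselRatio Δ ϑ k + (ϑ * Δ)⁻¹ * |(k : ℝ)| - 1)

variable {ϑ Δ : ℝ}

lemma score_eq (hϑ : 0 < ϑ) (hΔ : 0 < Δ) (k : ℤ) : score Δ ϑ k =
    |(k : ℝ)| / ϑ + Δ * (ϑ * Δ / 2 * besselSlope k.natAbs ((ϑ * Δ / 2) ^ 2) - 1) := by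
  rw [score, besselRatio_eq (by positivity)]
  field_simp
  ring

lemma abs_score_sub_le (hϑ : 0 < ϑ) (hΔ : 0 < Δ) (k : ℤ) :
    |score Δ ϑ k - |(k : ℝ)| / ϑ| ≤ Δ * (1 + ϑ * Δ) := by
  have hslope := besselSlope_nonneg (k := k.natAbs) (sq_nonneg (ϑ * Δ / 2))
  have hcorr : ϑ * Δ / 2 * besselSlope k.natAbs ((ϑ * Δ / 2) ^ 2) ≤ ϑ * Δ / 1 * 1 := by
    gcongr
    · norm_num
    · exact besselSlope_le_one (sq_nonneg _)
  have hcorr₀ : 0 ≤ ϑ * Δ / 2 * besselSlope k.natAbs ((ϑ * Δ / 2) ^ 2) := by positivity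
  rw [score_eq hϑ hΔ, add_sub_cancel_left, abs_mul, abs_of_pos hΔ]
  gcongr
  rw [abs_le]
  constructor <;> linarith

lemma abs_score_le (hϑ : 0 < ϑ) (hΔ : 0 < Δ) (k : ℤ) :
    |score Δ ϑ k| ≤ (1 / ϑ + Δ * (1 + ϑ * Δ)) * Real.exp k.natAbs := by
  have htri := (abs_sub_abs_le_abs_sub _ _).trans (abs_score_sub_le hϑ hΔ k)
  rw [abs_of_nonneg (a := |(k : ℝ)| / ϑ) (by positivity)] at htri
  rw [Nat.cast_natAbs, Int.cast_abs]
  have habs : |(k : ℝ)| / ϑ ≤ 1 / ϑ * Real.exp |(k : ℝ)| := by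
    rw [div_eq_inv_mul, one_div]
    gcongr
    linarith [Real.add_one_le_exp |(k : ℝ)|]
  have hconst : Δ * (1 + ϑ * Δ) ≤ Δ * (1 + ϑ * Δ) * Real.exp |(k : ℝ)| :=
    le_mul_of_one_le_right (by positivity) (Real.one_le_exp (abs_nonneg _))
  linarith

lemma norm_score_sq_le (hϑ : 0 < ϑ) (hΔ : 0 < Δ) (k : ℤ) :
    ‖score Δ ϑ k ^ 2‖ ≤ (1 / ϑ + Δ * (1 + ϑ * Δ)) ^ 2 * Real.exp (2 * k.natAbs) := by
  rw [norm_pow, Real.norm_eq_abs, two_mul, Real.exp_add, ← sq, ← mul_pow]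
  gcongr
  exact abs_score_le hϑ hΔ k

lemma memLp_score (hϑ : 0 < ϑ) (hΔ : 0 < Δ) : MemLp (score Δ ϑ) 2 (skellamMeasure (ϑ * Δ)) :=
  (memLp_two_iff_integrable_sq (by fun_prop)).mpr
    (integrable_skellamMeasure (by positivity) (norm_score_sq_le hϑ hΔ))

lemma skellamProb_mul_score (hϑ : 0 < ϑ) (hΔ : 0 < Δ) (k : ℤ) :
    skellamProb (ϑ * Δ) k * score Δ ϑ k = Δ * ((skellamProb (ϑ * Δ) (k + 1) +
      skellamProb (ϑ * Δ) (k - 1)) / 2 - skellamProb (ϑ * Δ) k) := by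
  have hcancel : besselI k.natAbs (ϑ * Δ) * besselRatio Δ ϑ k = besselI (k.natAbs + 1) (ϑ * Δ) :=
    mul_div_cancel₀ _ (besselI_pos (by positivity) _).ne'
  have hrec := besselI_natAbs_recurrence (x := ϑ * Δ) (by positivity) k
  simp only [score, skellamProb]
  linear_combination Real.exp (-(ϑ * Δ)) * Δ * (hcancel + hrec)

lemma hasSum_discrete_laplacian {p : ℤ → ℝ} (hp : Summable p) :
    HasSum (fun k => (p (k + 1) + p (k - 1)) / 2 - p k) 0 := by
  have hright : HasSum (fun k => p (k + 1)) (∑' k, p k) :=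
    (Equiv.addRight (1 : ℤ)).hasSum_iff.mpr hp.hasSum
  have hleft : HasSum (fun k => p (k - 1)) (∑' k, p k) :=
    (Equiv.subRight (1 : ℤ)).hasSum_iff.mpr hp.hasSum
  simpa using ((hright.add hleft).div_const 2).sub hp.hasSum

lemma integral_score (hϑ : 0 < ϑ) (hΔ : 0 < Δ) :
    ∫ k, score Δ ϑ k ∂skellamMeasure (ϑ * Δ) = 0 := by
  rw [integral_countable ((memLp_score hϑ hΔ).integrable one_le_two)]
  simp_rw [skellamMeasure_real_singleton (mul_pos hϑ hΔ).le, smul_eq_mul,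
    skellamProb_mul_score hϑ hΔ]
  rw [tsum_mul_left, (hasSum_discrete_laplacian
    (summable_skellamProb (mul_pos hϑ hΔ).le)).tsum_eq, mul_zero]

lemma integral_score_sq_pos (hϑ : 0 < ϑ) (hΔ : 0 < Δ) :
    0 < ∫ k, score Δ ϑ k ^ 2 ∂skellamMeasure (ϑ * Δ) := by
  rw [integral_pos_iff_support_of_nonneg (fun k => sq_nonneg _) (memLp_score hϑ hΔ).integrable_sq]
  obtain ⟨j, hj⟩ := exists_nat_gt (ϑ * Δ)
  have hscore : 0 < score Δ ϑ j := by
    have hlarge : Δ < (j : ℝ) / ϑ := by rw [lt_div_iff₀ hϑ]; linarith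
    have hslope := besselSlope_nonneg (k := j) (sq_nonneg (ϑ * Δ / 2))
    have hcorr : 0 ≤ Δ * (ϑ * Δ / 2 * besselSlope j ((ϑ * Δ / 2) ^ 2)) := by positivity
    rw [score_eq hϑ hΔ, Int.cast_natCast, Nat.abs_cast, Int.natAbs_natCast]
    linarith
  have hmass : 0 < (skellamMeasure (ϑ * Δ)).real {(j : ℤ)} := by
    rw [skellamMeasure_real_singleton (mul_pos hϑ hΔ).le]
    exact skellamProb_pos (mul_pos hϑ hΔ) j
  exact (ENNReal.toReal_pos_iff.mp hmass).1.trans_le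
    (measure_mono (Set.singleton_subset_iff.mpr (pow_pos hscore 2).ne'))

variable {ι : Type*} {l : Filter ι} {D : ι → ℝ}

lemma eventually_pos_and_le_one (hD : Tendsto D l (𝓝[>] 0)) : ∀ᶠ i in l, 0 < D i ∧ D i ≤ 1 :=
  (hD.eventually self_mem_nhdsWithin).and
    ((hD.mono_right nhdsWithin_le_nhds).eventually (ge_mem_nhds one_pos))

lemma tendsto_mul_one_add_mul (hD : Tendsto D l (𝓝[>] 0)) (ϑ : ℝ) :
    Tendsto (fun i => D i * (1 + ϑ * D i)) l (𝓝 0) := by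
  have hD0 := hD.mono_right nhdsWithin_le_nhds
  simpa using hD0.mul ((hD0.const_mul ϑ).const_add 1)

lemma tendsto_score (hϑ : 0 < ϑ) (hD : Tendsto D l (𝓝[>] 0)) (k : ℤ) :
    Tendsto (fun i => score (D i) ϑ k) l (𝓝 (|(k : ℝ)| / ϑ)) := by
  rw [tendsto_iff_norm_sub_tendsto_zero]
  refine squeeze_zero' (.of_forall fun _ => norm_nonneg _) ?_ (tendsto_mul_one_add_mul hD ϑ)
  filter_upwards [eventually_pos_and_le_one hD] with i hi using abs_score_sub_le hϑ hi.1 k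

lemma tendsto_inv_mul_score_zero_sq (hϑ : 0 < ϑ) (hD : Tendsto D l (𝓝[>] 0)) :
    Tendsto (fun i => (D i)⁻¹ * score (D i) ϑ 0 ^ 2) l (𝓝 0) := by
  have hbound : Tendsto (fun i => D i * (1 + ϑ * D i) * (1 + ϑ * D i)) l (𝓝 0) := by
    simpa using (tendsto_mul_one_add_mul hD ϑ).mul
      (((hD.mono_right nhdsWithin_le_nhds).const_mul ϑ).const_add 1)
  have hpos := eventually_pos_and_le_one hD
  refine squeeze_zero' ?_ ?_ hbound <;> filter_upwards [hpos] with i hi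
  · exact mul_nonneg (inv_nonneg.mpr hi.1.le) (sq_nonneg _)
  · have hle := abs_score_sub_le hϑ hi.1 0
    rw [Int.cast_zero, abs_zero, zero_div, sub_zero] at hle
    rw [inv_mul_le_iff₀ hi.1]
    calc score (D i) ϑ 0 ^ 2 ≤ (D i * (1 + ϑ * D i)) ^ 2 :=
          sq_le_sq' (abs_le.mp hle).1 (abs_le.mp hle).2
      _ = _ := by ring

variable {E : Type*} [NormedAddCommGroup E] [NormedSpace ℝ E] [CompleteSpace E]
  {f : ι → ℤ → E} {C : ℝ} {a b : E}

theorem tendsto_inv_smul_integral_increment (hϑ : 0 < ϑ) (hD : Tendsto D l (𝓝[>] 0))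
    (hf : ∀ᶠ i in l, ∀ k, ‖f i k‖ ≤ C * Real.exp (2 * k.natAbs))
    (h₀ : Tendsto (fun i => (D i)⁻¹ • f i 0) l (𝓝 0)) (h₁ : Tendsto (fun i => f i 1) l (𝓝 a))
    (h₂ : Tendsto (fun i => f i (-1)) l (𝓝 b)) :
    Tendsto (fun i => (D i)⁻¹ • ∫ k, f i k ∂skellamMeasure (ϑ * D i)) l
      (𝓝 ((ϑ / 2) • (a + b))) := by
  have hlam : Tendsto (fun i => ϑ * D i) l (𝓝[>] 0) := by
    rw [tendsto_nhdsWithin_iff] at hD ⊢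
    exact ⟨by simpa using hD.1.const_mul ϑ, hD.2.mono fun i hi => mul_pos hϑ hi⟩
  have h₀' : Tendsto (fun i => (ϑ * D i)⁻¹ • f i 0) l (𝓝 0) := by
    simpa only [mul_inv, mul_smul, smul_zero] using h₀.const_smul ϑ⁻¹
  have hlim := (tendsto_inv_smul_integral_skellamMeasure hlam hf h₀' h₁ h₂).const_smul ϑ
  simp_rw [smul_smul, mul_inv, mul_inv_cancel_left₀ hϑ.ne', mul_one_div] at hlim
  exact hlim

theorem tendsto_integral_score_sq (hϑ : 0 < ϑ) (hD : Tendsto D l (𝓝[>] 0)) :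
    Tendsto (fun i => (D i)⁻¹ * ∫ k, score (D i) ϑ k ^ 2 ∂skellamMeasure (ϑ * D i)) l
      (𝓝 (1 / ϑ)) := by
  have hbound : ∀ᶠ i in l, ∀ k, ‖score (D i) ϑ k ^ 2‖ ≤
      (1 / ϑ + 1 * (1 + ϑ * 1)) ^ 2 * Real.exp (2 * k.natAbs) := by
    filter_upwards [eventually_pos_and_le_one hD] with i ⟨hi, hi₁⟩ k
    refine (norm_score_sq_le hϑ hi k).trans ?_
    gcongr
  convert! tendsto_inv_smul_integral_increment hϑ hD hbound (tendsto_inv_mul_score_zero_sq hϑ hD)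
    ((tendsto_score hϑ hD 1).pow 2) ((tendsto_score hϑ hD (-1)).pow 2) using 2
  simp only [Int.cast_one, abs_one, Int.cast_neg, abs_neg, smul_eq_mul]
  field_simp
  norm_num

theorem tendsto_integral_abs (hϑ : 0 < ϑ) (hD : Tendsto D l (𝓝[>] 0)) :
    Tendsto (fun i => (D i)⁻¹ * ∫ k, |(k : ℝ)| ∂skellamMeasure (ϑ * D i)) l (𝓝 ϑ) := by
  convert! tendsto_inv_smul_integral_increment hϑ hD (f := fun _ k => |(k : ℝ)|) (C := 1)
    (.of_forall fun _ k => ?_) (by simpa using tendsto_const_nhds)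
    tendsto_const_nhds tendsto_const_nhds using 2
  · norm_num
  · rw [Real.norm_eq_abs, abs_abs, one_mul, Nat.cast_natAbs, Int.cast_abs]
    linarith [Real.add_one_le_exp (2 * |(k : ℝ)|), abs_nonneg (k : ℝ)]

lemma abs_sq_le_exp (k : ℤ) : ‖|(k : ℝ)| ^ 2‖ ≤ 1 * Real.exp (2 * k.natAbs) := by
  rw [norm_pow, Real.norm_eq_abs, abs_abs, one_mul, two_mul, Real.exp_add, ← sq, Nat.cast_natAbs,
    Int.cast_abs]
  gcongr
  linarith [Real.add_one_le_exp |(k : ℝ)|]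

lemma memLp_abs (h : 0 ≤ Δ) : MemLp (fun k : ℤ => |(k : ℝ)|) 2 (skellamMeasure Δ) :=
  (memLp_two_iff_integrable_sq (by fun_prop)).mpr (integrable_skellamMeasure h abs_sq_le_exp)

theorem tendsto_integral_abs_sq (hϑ : 0 < ϑ) (hD : Tendsto D l (𝓝[>] 0)) :
    Tendsto (fun i => (D i)⁻¹ * ∫ k, |(k : ℝ)| ^ 2 ∂skellamMeasure (ϑ * D i)) l (𝓝 ϑ) := by
  convert! tendsto_inv_smul_integral_increment hϑ hD (f := fun _ k => |(k : ℝ)| ^ 2)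
    (.of_forall fun _ => abs_sq_le_exp) (by simpa using tendsto_const_nhds)
    tendsto_const_nhds tendsto_const_nhds using 2
  norm_num

end Score

section Signs

variable {Ω ι κ : Type*} [MeasurableSpace Ω] {P : Measure Ω} [IsProbabilityMeasure P]
  {ε : ι → Ω → ℤ}

/-- The `ε i` are independent symmetric signs under `P`, the jumps of the compound process. -/
structure IsRademacher (P : Measure Ω) (ε : ι → Ω → ℤ) : Prop where
  measurable : ∀ i, Measurable (ε i)
  sign_pos : ∀ i, P {ω | ε i ω = 1} = 1 / 2
  sign_neg : ∀ i, P {ω | ε i ω = -1} = 1 / 2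
  indep : iIndepFun ε P

lemma IsRademacher.ae_eq (h : IsRademacher P ε) (i : ι) : ∀ᵐ ω ∂P, ε i ω = 1 ∨ ε i ω = -1 := by
  have h₁ : MeasurableSet {ω | ε i ω = 1} := measurableSet_eq_fun (h.measurable i) measurable_const
  have h₂ : MeasurableSet {ω | ε i ω = -1} := measurableSet_eq_fun (h.measurable i) measurable_const
  have hdisj : Disjoint {ω | ε i ω = 1} {ω | ε i ω = -1} :=
    Set.disjoint_left.2 fun ω (h : ε i ω = 1) (h' : ε i ω = -1) => by omega
  refine mem_ae_iff.2 ((prob_compl_eq_zero_iff (h₁.union h₂)).2 ?_)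
  rw [measure_union hdisj h₂, h.sign_pos, h.sign_neg, one_div, ENNReal.inv_two_add_inv_two]

lemma IsRademacher.measureReal_sum (h : IsRademacher P ε) (s : Finset ι) (k : ℤ) :
    P.real {ω | ∑ i ∈ s, ε i ω = k} = walkProb s.card k := by
  classical
  induction s using Finset.induction_on generalizing k with
  | empty =>
    rcases eq_or_ne k 0 with rfl | hk
    · simp [walkProb]
    · simp [walkProb, hk, hk.symm]
  | insert a s ha ih =>
    have hindep : IndepFun (fun ω => ∑ i ∈ s, ε i ω) (ε a) P := by
      simpa only [Finset.sum_fn] using h.indep.indepFun_finsetSum_of_notMem h.measurable ha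
    have hprod : ∀ c d : ℤ, P.real ({ω | ∑ i ∈ s, ε i ω = c} ∩ {ω | ε a ω = d}) =
        walkProb s.card c * P.real {ω | ε a ω = d} := fun c d => by
      have := congrArg ENNReal.toReal
        (hindep.measure_inter_preimage_eq_mul {c} {d} .of_discrete .of_discrete)
      rw [ENNReal.toReal_mul] at this
      rw [← ih c]
      exact this
    have hsplit : {ω | ∑ i ∈ insert a s, ε i ω = k} =ᵐ[P]
        ({ω | ∑ i ∈ s, ε i ω = k - 1} ∩ {ω | ε a ω = 1} ∪
          {ω | ∑ i ∈ s, ε i ω = k + 1} ∩ {ω | ε a ω = -1} : Set Ω) := by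
      filter_upwards [h.ae_eq a] with ω hω
      refine propext (?_ : _ = k ↔ _ = k - 1 ∧ ε a ω = 1 ∨ _ = k + 1 ∧ ε a ω = -1)
      rw [Finset.sum_insert ha]
      omega
    have hdisj : Disjoint ({ω | ∑ i ∈ s, ε i ω = k - 1} ∩ {ω | ε a ω = 1})
        ({ω | ∑ i ∈ s, ε i ω = k + 1} ∩ {ω | ε a ω = -1}) :=
      Set.disjoint_left.2 fun ω ⟨_, (h : ε a ω = 1)⟩ ⟨_, (h' : ε a ω = -1)⟩ => by omega
    have hmeas : MeasurableSet ({ω | ∑ i ∈ s, ε i ω = k + 1} ∩ {ω | ε a ω = -1}) :=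
      (measurableSet_eq_fun (Finset.measurable_sum _ fun i _ => h.measurable i)
        measurable_const).inter (measurableSet_eq_fun (h.measurable a) measurable_const)
    rw [measureReal_congr hsplit, measureReal_union hdisj hmeas, hprod, hprod,
      Finset.card_insert_of_notMem ha, measureReal_def, measureReal_def, h.sign_pos, h.sign_neg]
    simp only [walkProb, one_div, ENNReal.toReal_inv, ENNReal.toReal_ofNat]
    ring

omit [IsProbabilityMeasure P] in
lemma indepFun_sum_blocks (hm : ∀ i, Measurable (ε i)) (hε : iIndepFun ε P) {J : Finset κ}
    {S : κ → Finset ι} {s : Finset ι} (hs : ∀ j ∈ J, Disjoint (S j) s) :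
    IndepFun (fun ω (j : J) => ∑ i ∈ S j, ε i ω) (fun ω => ∑ i ∈ s, ε i ω) P := by
  classical
  have hJ : ∀ j : J, ∀ i ∈ S j, i ∈ J.biUnion S := fun j i hi =>
    Finset.mem_biUnion.2 ⟨j, j.2, hi⟩
  have := (hε.indepFun_finset _ _ ((Finset.disjoint_biUnion_left _ _ _).2 hs) hm).comp
    (φ := fun x (j : J) => ∑ i : S j, x ⟨i, hJ j i i.2⟩) (ψ := fun x => ∑ i, x i)
    .of_discrete .of_discrete
  convert! this using 1
  · ext ω j
    exact (Finset.sum_coe_sort (S j) fun i => ε i ω).symm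
  · ext ω
    exact (Finset.sum_coe_sort s fun i => ε i ω).symm

lemma IsRademacher.measureReal_sum_blocks (h : IsRademacher P ε) (J : Finset κ) {S : κ → Finset ι}
    (hS : (J : Set κ).PairwiseDisjoint S) (y : κ → ℤ) :
    P.real {ω | ∀ j ∈ J, ∑ i ∈ S j, ε i ω = y j} = ∏ j ∈ J, walkProb (S j).card (y j) := by
  classical
  induction J using Finset.induction_on with
  | empty => simp
  | insert a J ha ih =>
    rw [Finset.coe_insert, Set.pairwiseDisjoint_insert_of_notMem (Finset.mem_coe.not.2 ha)] at hS
    have hindep := indepFun_sum_blocks h.measurable h.indep fun j hj => (hS.2 j hj).symm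
    let Y : J → ℤ := fun j => y j
    have hblocks : {ω | ∀ j ∈ J, ∑ i ∈ S j, ε i ω = y j} =
        (fun ω (j : J) => ∑ i ∈ S j, ε i ω) ⁻¹' {Y} := by
      ext ω
      simp [Y, funext_iff]
    have hinsert : {ω | ∀ j ∈ insert a J, ∑ i ∈ S j, ε i ω = y j} =
        (fun ω (j : J) => ∑ i ∈ S j, ε i ω) ⁻¹' {Y} ∩ (fun ω => ∑ i ∈ S a, ε i ω) ⁻¹' {y a} := by
      ext ω
      simp [Y, funext_iff, and_comm]
    have := congrArg ENNReal.toReal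
      (hindep.measure_inter_preimage_eq_mul {Y} {y a} .of_discrete .of_discrete)
    rw [ENNReal.toReal_mul] at this
    rw [Finset.prod_insert ha, ← ih hS.1, ← h.measureReal_sum, mul_comm, hblocks, hinsert]
    exact this

lemma IsRademacher.measureReal_sum_random_blocks {α : Type*} [Countable α] [MeasurableSpace α]
    [DiscreteMeasurableSpace α] [Fintype κ] (h : IsRademacher P ε) {M : Ω → α} (hM : Measurable M)
    (hεM : IndepFun (fun ω i => ε i ω) M P) {S : α → κ → Finset ι}
    (hS : ∀ m, Pairwise (Function.onFun Disjoint (S m))) (y : κ → ℤ) :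
    P.real {ω | ∀ j, ∑ i ∈ S (M ω) j, ε i ω = y j} =
      ∫ m, ∏ j, walkProb (S m j).card (y j) ∂P.map M := by
  have hε : Measurable (fun ω i => ε i ω) := measurable_pi_lambda _ h.measurable
  let B : α → Set (ι → ℤ) := fun m => {e | ∀ j, ∑ i ∈ S m j, e i = y j}
  have hB : ∀ m, MeasurableSet (B m) := fun m => by
    simp only [B, Set.ofPred_forall]
    exact .iInter fun j => measurableSet_eq_fun
      (Finset.measurable_sum _ fun i _ => measurable_pi_apply i) measurable_const
  have hBpair : MeasurableSet {p : (ι → ℤ) × α | p.1 ∈ B p.2} := by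
    convert! MeasurableSet.iUnion fun m => (hB m).prod (measurableSet_singleton m)
    ext ⟨e, m⟩
    simp
  have hprob : ∀ m, ((P.map fun ω i => ε i ω) (B m)).toReal =
      ∏ j, walkProb (S m j).card (y j) := fun m => by
    rw [Measure.map_apply hε (hB m), ← h.measureReal_sum_blocks Finset.univ
      fun i _ j _ hij => hS m hij]
    simp [B, measureReal_def]
  calc P.real {ω | ∀ j, ∑ i ∈ S (M ω) j, ε i ω = y j}
      = (P.map (fun ω => ((fun i => ε i ω), M ω))).real {p | p.1 ∈ B p.2} := by
        rw [map_measureReal_apply (hε.prodMk hM) hBpair]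
        rfl
    _ = (∫⁻ m, (P.map fun ω i => ε i ω) (B m) ∂P.map M).toReal := by
        rw [(indepFun_iff_map_prod_eq_prod_map_map hε.aemeasurable hM.aemeasurable).1 hεM,
          measureReal_def, Measure.prod_apply_symm hBpair]
        rfl
    _ = _ := by
        have := Measure.isProbabilityMeasure_map (μ := P) hε.aemeasurable
        rw [← integral_toReal (.of_discrete) (ae_of_all _ fun m => measure_lt_top _ _)]
        simp only [hprob]

end Signs

section Increments

variable {Ω : Type*} [MeasurableSpace Ω] {P : Measure Ω} {ϑ : ℝ} {N : ℝ≥0 → Ω → ℕ}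
  {ε : ℕ → Ω → ℤ} {n : ℕ} {t : Fin (n + 1) → ℝ≥0}

lemma map_toNat_map_natCast (μ : Measure ℕ) :
    (μ.map fun n : ℕ => (n : ℤ)).map Int.toNat = μ := by
  rw [Measure.map_map .of_discrete .of_discrete]
  exact Measure.map_id

lemma IsPoissonProcess.map_sub (h : IsPoissonProcess P ϑ N) {s t : ℝ≥0} (hst : s ≤ t) :
    P.map (fun ω => N t ω - N s ω) = poissonMeasure (ϑ.toNNReal * (t - s)) := by
  have hlaw := h.increment_law s t hst
  rw [← map_toNat_map_natCast (poissonMeasure _), ← hlaw.map_eq,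
    AEMeasurable.map_map_of_aemeasurable .of_discrete hlaw.aemeasurable]
  congr with ω
  simp

lemma IsPoissonProcess.measurable_increments (h : IsPoissonProcess P ϑ N)
    (t : Fin (n + 1) → ℝ≥0) :
    Measurable fun ω (j : Fin n) => N (t j.succ) ω - N (t j.castSucc) ω :=
  measurable_pi_lambda _ fun _ => (h.measurable _).sub (h.measurable _)

lemma IsPoissonProcess.map_increments (h : IsPoissonProcess P ϑ N) (ht : Monotone t) :
    P.map (fun ω (j : Fin n) => N (t j.succ) ω - N (t j.castSucc) ω) =
      Measure.pi fun j : Fin n => poissonMeasure (ϑ.toNNReal * (t j.succ - t j.castSucc)) := by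
  have hindep : iIndepFun (fun (j : Fin n) ω => N (t j.succ) ω - N (t j.castSucc) ω) P := by
    convert! (h.indep_increments n t ht).comp (fun _ => Int.toNat) fun _ => .of_discrete
      using 3 with j
    simp
  refine (hindep.map_fun_eq_pi_map
    fun j => ((h.measurable _).sub (h.measurable _)).aemeasurable).trans ?_
  exact congrArg Measure.pi (funext fun j => h.map_sub (ht (Fin.castSucc_lt_succ).le))

lemma IsPoissonProcess.ae_eq_partialSum (h : IsPoissonProcess P ϑ N) (ht : Monotone t)
    (h₀ : t 0 = 0) : ∀ᵐ ω ∂P, ∀ i, N (t i) ω =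
      Fin.partialSum (fun j : Fin n => N (t j.succ) ω - N (t j.castSucc) ω) i := by
  filter_upwards [h.start_zero, h.mono] with ω hzero hmono i
  induction i using Fin.induction with
  | zero => rw [h₀, hzero, Fin.partialSum_zero]
  | succ j ih =>
    have := hmono (ht (Fin.castSucc_lt_succ (i := j)).le)
    rw [Fin.partialSum_succ, ← ih]
    exact (Nat.add_sub_cancel' this).symm

lemma IsModel.isRademacher (h : IsModel P ϑ N ε) : IsRademacher P ε :=
  ⟨h.measurable_sign, h.sign_pos, h.sign_neg, h.sign_indep⟩

lemma IsModel.measurable_compound (h : IsModel P ϑ N ε) (t : ℝ≥0) :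
    Measurable (compound N ε t) := by
  have : Measurable fun p : ℕ × Ω => ∑ i ∈ Finset.range p.1, ε i p.2 :=
    measurable_from_prod_countable_right fun n =>
      Finset.measurable_sum (Finset.range n) fun i _ => h.measurable_sign i
  exact this.comp ((h.poisson.measurable t).prodMk measurable_id)

lemma IsModel.ae_compound_zero (h : IsModel P ϑ N ε) : ∀ᵐ ω ∂P, compound N ε 0 ω = 0 := by
  filter_upwards [h.poisson.start_zero] with ω hω
  simp [compound, hω]

/-- The indices of the jumps of the `j`-th time interval, `m i` being the number of jumps of the
`i`-th interval. -/
def jumpIndices (m : Fin n → ℕ) (j : Fin n) : Finset ℕ :=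
  Finset.Ico (Fin.partialSum m j.castSucc) (Fin.partialSum m j.succ)

lemma partialSum_mono (m : Fin n → ℕ) : Monotone (Fin.partialSum m) :=
  Fin.monotone_iff_le_succ.2 fun j => (Nat.le_add_right _ _).trans (Fin.partialSum_succ m j).ge

lemma card_jumpIndices (m : Fin n → ℕ) (j : Fin n) : (jumpIndices m j).card = m j := by
  rw [jumpIndices, Nat.card_Ico, Fin.partialSum_succ, Nat.add_sub_cancel_left]

lemma pairwise_disjoint_jumpIndices (m : Fin n → ℕ) :
    Pairwise (Function.onFun Disjoint (jumpIndices m)) :=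
  (pairwise_disjoint_on _).2 fun i j hij => Finset.disjoint_left.2 fun k hi hj => by
    have := partialSum_mono m (Fin.succ_le_castSucc_iff.2 hij)
    simp only [jumpIndices, Finset.mem_Ico] at hi hj
    omega

lemma IsModel.ae_compound_sub_eq_sum (h : IsModel P ϑ N ε) (ht : Monotone t) (h₀ : t 0 = 0) :
    ∀ᵐ ω ∂P, ∀ j : Fin n, compound N ε (t j.succ) ω - compound N ε (t j.castSucc) ω =
      ∑ i ∈ jumpIndices (fun j : Fin n => N (t j.succ) ω - N (t j.castSucc) ω) j, ε i ω := by
  filter_upwards [h.poisson.ae_eq_partialSum ht h₀] with ω hω j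
  rw [jumpIndices, ← hω, ← hω, Finset.sum_Ico_eq_sub]
  · rfl
  · rw [hω, hω]
    exact partialSum_mono _ (Fin.castSucc_lt_succ).le

lemma integral_prod_walkProb (lam : Fin n → ℝ≥0) (y : Fin n → ℤ) :
    ∫ m, ∏ j, walkProb (m j) (y j) ∂(Measure.pi fun j => poissonMeasure (lam j)) =
      ∏ j, skellamProb (lam j) (y j) := by
  simp_rw [integral_fintype_prod_eq_prod (f := fun j k => walkProb k (y j)),
    integral_walkProb_poissonMeasure]

lemma IsModel.measurable_compound_increments (h : IsModel P ϑ N ε) (t : Fin (n + 1) → ℝ≥0) :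
    Measurable fun ω (j : Fin n) =>
      compound N ε (t j.succ) ω - compound N ε (t j.castSucc) ω :=
  measurable_pi_lambda _ fun _ => (h.measurable_compound _).sub (h.measurable_compound _)

lemma IsModel.map_compound_increments (h : IsModel P ϑ N ε) (hϑ : 0 ≤ ϑ) (ht : Monotone t)
    (h₀ : t 0 = 0) :
    P.map (fun ω (j : Fin n) => compound N ε (t j.succ) ω - compound N ε (t j.castSucc) ω) =
      Measure.pi fun j : Fin n => skellamMeasure (ϑ * (t j.succ - t j.castSucc : ℝ≥0)) := by
  have := h.isProbabilityMeasure
  have hmeas := h.measurable_compound_increments t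
  have := Measure.isProbabilityMeasure_map (μ := P) hmeas.aemeasurable
  have hN := h.poisson.measurable_increments t
  have hεN : IndepFun (fun ω i => ε i ω)
      (fun ω (j : Fin n) => N (t j.succ) ω - N (t j.castSucc) ω) P :=
    h.indep.comp (ψ := fun (x : ℝ≥0 → ℕ) (j : Fin n) => x (t j.succ) - x (t j.castSucc))
      measurable_id (measurable_pi_lambda _ fun j => (measurable_pi_apply _).sub
        (measurable_pi_apply _))
  refine Measure.ext_of_singleton fun y => ?_
  rw [← measureReal_eq_measureReal_iff, map_measureReal_apply hmeas .of_discrete,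
    measureReal_def (Measure.pi _), Measure.pi_singleton, ENNReal.toReal_prod]
  calc P.real {ω | (fun j : Fin n =>
        compound N ε (t j.succ) ω - compound N ε (t j.castSucc) ω) = y}
      = P.real {ω | ∀ j, ∑ i ∈ jumpIndices
          (fun j : Fin n => N (t j.succ) ω - N (t j.castSucc) ω) j, ε i ω = y j} := by
        refine measureReal_congr ?_
        filter_upwards [h.ae_compound_sub_eq_sum ht h₀] with ω hω
        exact propext (funext_iff.trans (forall_congr' fun j => by rw [hω j]))
    _ = ∏ j, skellamProb (ϑ * (t j.succ - t j.castSucc : ℝ≥0)) (y j) := by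
        rw [h.isRademacher.measureReal_sum_random_blocks hN hεN pairwise_disjoint_jumpIndices,
          h.poisson.map_increments ht]
        simp_rw [card_jumpIndices, integral_prod_walkProb, NNReal.coe_mul, Real.coe_toNNReal _ hϑ]
    _ = _ := Finset.prod_congr rfl fun j _ =>
        (skellamMeasure_real_singleton (mul_nonneg hϑ (NNReal.coe_nonneg _)) _).symm

lemma IsModel.map_compound (h : IsModel P ϑ N ε) (hϑ : 0 ≤ ϑ) (s : ℝ≥0) :
    P.map (compound N ε s) = skellamMeasure (ϑ * s) := by
  have hgrid : Monotone ![0, s] := Fin.monotone_iff_le_succ.2 fun j => by fin_cases j; simp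
  have := congrArg (Measure.map (Function.eval 0))
    (h.map_compound_increments hϑ hgrid (Matrix.cons_val_zero _ _))
  rw [Measure.map_map .of_discrete (h.measurable_compound_increments _),
    Measure.pi_map_eval] at this
  convert! this using 1
  · refine Measure.map_congr ?_
    filter_upwards [h.ae_compound_zero] with ω hω
    simp [hω]
  · simp

end Increments

section Observation

variable {Ω : Type*} [MeasurableSpace Ω] {P : Measure Ω} {ϑ T Δ : ℝ} {N : ℝ≥0 → Ω → ℕ}
  {ε : ℕ → Ω → ℤ} {n : ℕ}

/-- The increments of the finite sequence `0, z 0, z 1, …`. -/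
def increments (z : Fin n → ℤ) (j : Fin n) : ℤ :=
  z j - (Fin.cons 0 z : Fin (n + 1) → ℤ) j.castSucc

lemma partialSum_increments (z : Fin n → ℤ) : Fin.partialSum (increments z) = Fin.cons 0 z := by
  ext i
  induction i using Fin.induction with
  | zero => simp
  | succ j ih => rw [Fin.partialSum_succ, ih, increments, Fin.cons_succ, add_sub_cancel]

lemma increments_injective : Function.Injective (increments (n := n)) := fun z z' h =>
  Fin.cons_right_injective (α := fun _ => ℤ) 0 <| by
    rw [← partialSum_increments, ← partialSum_increments, h]

/-- The observation times `0, Δ, …, nΔ`, with the starting time `0` included. -/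
noncomputable def observationTimes (Δ : ℝ) (n : ℕ) (i : Fin (n + 1)) : ℝ≥0 :=
  (i * Δ : ℝ).toNNReal

lemma observationTimes_mono (hΔ : 0 ≤ Δ) (n : ℕ) : Monotone (observationTimes Δ n) :=
  fun _ _ hij => Real.toNNReal_le_toNNReal <|
    mul_le_mul_of_nonneg_right (Nat.cast_le.2 (Fin.val_le_of_le hij)) hΔ

lemma observationTimes_zero : observationTimes Δ n 0 = 0 := by simp [observationTimes]

lemma observationTimes_succ_sub (hΔ : 0 ≤ Δ) (j : Fin n) :
    ((observationTimes Δ n j.succ - observationTimes Δ n j.castSucc : ℝ≥0) : ℝ) = Δ := by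
  have : ((j.succ : ℕ) * Δ : ℝ) = (j.castSucc : ℕ) * Δ + Δ := by
    rw [Fin.val_succ, Fin.val_castSucc]
    push_cast
    ring
  rw [observationTimes, observationTimes, this, Real.toNNReal_add (by positivity) hΔ,
    add_tsub_cancel_left, Real.coe_toNNReal _ hΔ]

lemma IsModel.measurable_observation (h : IsModel P ϑ N ε) (T Δ : ℝ) :
    Measurable fun ω (i : Fin ⌊T / Δ⌋₊) => compound N ε (((i : ℕ) + 1 : ℝ) * Δ).toNNReal ω :=
  measurable_pi_lambda _ fun _ => h.measurable_compound _

lemma IsModel.isProbabilityMeasure_observationLaw (h : IsModel P ϑ N ε) (T Δ : ℝ) :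
    IsProbabilityMeasure (observationLaw P (compound N ε) T Δ) :=
  have := h.isProbabilityMeasure
  Measure.isProbabilityMeasure_map (h.measurable_observation T Δ).aemeasurable

lemma IsModel.map_increments_observationLaw (h : IsModel P ϑ N ε) (hϑ : 0 ≤ ϑ) (T : ℝ)
    (hΔ : 0 ≤ Δ) : (observationLaw P (compound N ε) T Δ).map increments =
      Measure.pi fun _ => skellamMeasure (ϑ * Δ) := by
  have hlaw := h.map_compound_increments hϑ (observationTimes_mono hΔ ⌊T / Δ⌋₊)
    observationTimes_zero
  simp_rw [observationTimes_succ_sub hΔ] at hlaw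
  rw [← hlaw, observationLaw, Measure.map_map .of_discrete (h.measurable_observation T Δ)]
  refine Measure.map_congr ?_
  filter_upwards [h.ae_compound_zero] with ω hω
  have hvalue : (Fin.cons 0 fun i : Fin ⌊T / Δ⌋₊ =>
      compound N ε (((i : ℕ) + 1 : ℝ) * Δ).toNNReal ω : Fin (⌊T / Δ⌋₊ + 1) → ℤ) =
      fun i => compound N ε (observationTimes Δ _ i) ω := by
    ext i
    cases i using Fin.cases with
    | zero => rw [Fin.cons_zero, observationTimes_zero, hω]
    | succ j => simp [observationTimes]
  ext j
  rw [Function.comp_apply, increments, hvalue]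
  simp [observationTimes]

lemma IsModel.observationLaw_real_singleton (h : IsModel P ϑ N ε) (hϑ : 0 ≤ ϑ) (hΔ : 0 ≤ Δ)
    (z : Fin ⌊T / Δ⌋₊ → ℤ) : (observationLaw P (compound N ε) T Δ).real {z} =
      ∏ j, skellamProb (ϑ * Δ) (increments z j) := by
  simp_rw [← skellamMeasure_real_singleton (mul_nonneg hϑ hΔ), measureReal_def]
  rw [← ENNReal.toReal_prod, ← Measure.pi_singleton (fun _ => skellamMeasure (ϑ * Δ)),
    ← h.map_increments_observationLaw hϑ T hΔ, Measure.map_apply .of_discrete .of_discrete,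
    ← Set.image_singleton, Set.preimage_image_eq _ increments_injective]

end Observation

section Probability

lemma integral_sub_const_sq {Ω : Type*} [MeasurableSpace Ω] {μ : Measure Ω}
    [IsProbabilityMeasure μ] {X : Ω → ℝ} (hX : MemLp X 2 μ) (c : ℝ) :
    ∫ ω, (X ω - c) ^ 2 ∂μ = variance X μ + (∫ ω, X ω ∂μ - c) ^ 2 := by
  have h := variance_eq_sub (hX.sub (memLp_const c))
  have hmean : ∫ ω, (X - fun _ : Ω => c) ω ∂μ = ∫ ω, X ω ∂μ - c := by
    simp only [Pi.sub_apply]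
    rw [integral_sub (hX.integrable one_le_two) (integrable_const c), integral_const,
      probReal_univ, one_smul]
  rw [hmean, show X - (fun _ => c) = fun ω => X ω - c from rfl,
    variance_sub_const hX.aestronglyMeasurable] at h
  rw [h, sub_add_cancel]
  rfl

lemma absolutelyContinuous_of_measureReal_singleton_pos {α : Type*} [MeasurableSpace α]
    {μ ν : Measure α} (h : ∀ x, 0 < ν.real {x}) : μ ≪ ν := by
  refine Measure.AbsolutelyContinuous.mk fun s _ hs => ?_
  rcases s.eq_empty_or_nonempty with rfl | ⟨x, hx⟩
  · exact measure_empty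
  · have hx0 : ν {x} = 0 := measure_mono_null (Set.singleton_subset_iff.mpr hx) hs
    exact absurd (measureReal_eq_zero_iff (by simp [hx0]) |>.mpr hx0) (h x).ne'

lemma toReal_rnDeriv_mul_measureReal_singleton {α : Type*} [MeasurableSpace α]
    [MeasurableSingletonClass α] {μ ν : Measure α} [SigmaFinite μ] [SigmaFinite ν] (h : μ ≪ ν)
    (x : α) : (μ.rnDeriv ν x).toReal * ν.real {x} = μ.real {x} := by
  rw [measureReal_def, measureReal_def, ← ENNReal.toReal_mul]
  congr 1
  conv_rhs => rw [← Measure.withDensity_rnDeriv_eq μ ν h]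
  rw [withDensity_apply _ (measurableSet_singleton x), Measure.restrict_singleton,
    lintegral_smul_measure, lintegral_dirac, smul_eq_mul, mul_comm]

variable {ι : Type*} {l : Filter ι} {𝓧 : ι → Type*} [∀ i, MeasurableSpace (𝓧 i)]
  {μ : ∀ i, Measure (𝓧 i)} [∀ i, IsProbabilityMeasure (μ i)]

lemma tendsto_measure_le_abs_of_abs_le_add {r Z : ∀ i, 𝓧 i → ℝ} {g : ι → ℝ}
    (hr : ∀ᶠ i in l, ∀ x, |r i x| ≤ g i + |Z i x|) (hg : Tendsto g l (𝓝 0))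
    (hZ : ∀ᶠ i in l, Integrable (fun x => Z i x ^ 2) (μ i))
    (hZ0 : Tendsto (fun i => ∫ x, Z i x ^ 2 ∂(μ i)) l (𝓝 0)) {δ : ℝ} (hδ : 0 < δ) :
    Tendsto (fun i => μ i {x | δ ≤ |r i x|}) l (𝓝 0) := by
  have hmaj : Tendsto (fun i => ENNReal.ofReal (((δ / 2) ^ 2)⁻¹ * ∫ x, Z i x ^ 2 ∂(μ i)))
      l (𝓝 0) := by
    simpa using ENNReal.tendsto_ofReal (hZ0.const_mul ((δ / 2) ^ 2)⁻¹)
  refine tendsto_of_tendsto_of_tendsto_of_le_of_le' tendsto_const_nhds hmaj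
    (Eventually.of_forall fun _ => zero_le) ?_
  filter_upwards [hr, hZ, hg.eventually (ge_mem_nhds (half_pos hδ))] with i hri hZi hgi
  have hchebyshev := mul_meas_ge_le_integral_of_nonneg (ae_of_all _ fun x => sq_nonneg (Z i x))
    hZi ((δ / 2) ^ 2)
  rw [← le_inv_mul_iff₀ (by positivity)] at hchebyshev
  refine (measure_mono fun x (hx : δ ≤ |r i x|) => ?_).trans
    ((ofReal_measureReal (measure_ne_top _ _)).symm.le.trans
      (ENNReal.ofReal_le_ofReal hchebyshev))
  change (δ / 2) ^ 2 ≤ Z i x ^ 2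
  rw [← sq_abs (Z i x)]
  have : δ / 2 ≤ |Z i x| := by linarith [hri x]
  gcongr

end Probability

section LANCriterion

lemma abs_log_one_add_sub_le {x : ℝ} (hx : |x| ≤ 1 / 2) :
    |Real.log (1 + x) - x + x ^ 2 / 2| ≤ 2 * (x ^ 2 * |x|) := by
  have h := Real.abs_log_sub_add_sum_range_le (x := -x) (by rw [abs_neg]; linarith) 2
  rw [abs_neg, sub_neg_eq_add] at h
  have hrest : |x| ^ (2 + 1) / (1 - |x|) ≤ 2 * (x ^ 2 * |x|) := by
    rw [div_le_iff₀ (by linarith), ← sq_abs x]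
    have := mul_nonneg (pow_nonneg (abs_nonneg x) 3) (sub_nonneg.mpr hx)
    ring_nf at this ⊢
    linarith
  refine le_trans (le_of_eq ?_) (h.trans hrest)
  congr 1
  simp only [Finset.sum_range_succ, Finset.sum_range_zero]
  norm_num
  ring

lemma abs_mul_log_one_add_sub_add_le {x : ℝ} (hx : |x| ≤ 1 / 2) (A c : ℝ) :
    |A * (Real.log (1 + x) - x) + c / 2| ≤ 2 * |x ^ 2 * A - c| + 2 * |c| * |x| := by
  have hlog := abs_log_one_add_sub_le hx
  set d := Real.log (1 + x) - x + x ^ 2 / 2 with hd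
  have hsplit : A * (Real.log (1 + x) - x) + c / 2 = A * d - (x ^ 2 * A - c) / 2 := by
    rw [hd]; ring
  have hAd : |A * d| ≤ 2 * (|x ^ 2 * A| * |x|) := by
    rw [abs_mul, abs_mul, abs_of_nonneg (sq_nonneg x)]
    calc |A| * |d| ≤ |A| * (2 * (x ^ 2 * |x|)) := by gcongr
      _ = _ := by ring
  have hxA : |x ^ 2 * A| ≤ |x ^ 2 * A - c| + |c| := by
    have := abs_add_le (x ^ 2 * A - c) c
    rwa [sub_add_cancel] at this
  have htri := abs_sub (A * d) ((x ^ 2 * A - c) / 2)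
  rw [abs_div, abs_two] at htri
  have hxAx : |x ^ 2 * A| * |x| ≤ |x ^ 2 * A - c| * (1 / 2) + |c| * |x| := by
    nlinarith [abs_nonneg x, abs_nonneg (x ^ 2 * A - c)]
  rw [hsplit]
  linarith [abs_nonneg (x ^ 2 * A - c)]

variable {ϑ : ℝ} {I : ℝ → ℝ}

lemma tendsto_div_sqrt_sq_mul (hI : ∀ T, 0 < T → 0 < I T)
    (hIT : Tendsto (fun T => T / I T) atTop (𝓝 ϑ)) (v : ℝ) :
    Tendsto (fun T => (v / √(I T)) ^ 2 * T) atTop (𝓝 (v ^ 2 * ϑ)) := by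
  refine (hIT.const_mul (v ^ 2)).congr' ?_
  filter_upwards [eventually_gt_atTop 0] with T hT
  rw [div_pow, Real.sq_sqrt (hI T hT).le]
  ring

lemma tendsto_zero_of_tendsto_sq_mul {y : ℝ → ℝ} {c : ℝ}
    (h : Tendsto (fun T => y T ^ 2 * T) atTop (𝓝 c)) : Tendsto y atTop (𝓝 0) := by
  have hsq : Tendsto (fun T => y T ^ 2) atTop (𝓝 0) := by
    refine (h.div_atTop tendsto_id).congr' ?_
    filter_upwards [eventually_gt_atTop 0] with T hT
    exact mul_div_cancel_right₀ _ hT.ne'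
  rw [tendsto_zero_iff_abs_tendsto_zero]
  have hsqrt := (Real.continuous_sqrt.tendsto 0).comp hsq
  rw [Real.sqrt_zero] at hsqrt
  exact hsqrt.congr fun T => Real.sqrt_sq_eq_abs _

variable {𝓧 : ℝ → Type*} [∀ T, MeasurableSpace (𝓧 T)] {Q : (T : ℝ) → ℝ → Measure (𝓧 T)}
  {S A : (T : ℝ) → 𝓧 T → ℝ} {ℓ : (T : ℝ) → ℝ → 𝓧 T → ℝ} {η : ℝ → ℝ}

lemma abs_remainder_le {T u v c s a L : ℝ} (hϑ : 0 < ϑ) (hT : 0 < T) (hu : |u| ≤ ϑ / 2)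
    (hL : |L - u * s - a * (Real.log (1 + u / ϑ) - u / ϑ)| ≤ c) :
    |L - u * s + v ^ 2 / 2| ≤
      c + 2 * v ^ 2 * |u / ϑ| + 2 * |u ^ 2 * T / ϑ - v ^ 2| +
        |2 * (u ^ 2 * T / ϑ ^ 2) * (a / T - ϑ)| := by
  have hx : |u / ϑ| ≤ 1 / 2 := by
    rw [abs_div, abs_of_pos hϑ, div_le_iff₀ hϑ]
    linarith
  have hquad := abs_mul_log_one_add_sub_add_le hx a (v ^ 2)
  rw [abs_of_nonneg (sq_nonneg v)] at hquad
  have htri := abs_add_le (L - u * s - a * (Real.log (1 + u / ϑ) - u / ϑ))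
    (a * (Real.log (1 + u / ϑ) - u / ϑ) + v ^ 2 / 2)
  rw [← add_assoc, sub_add_cancel] at htri
  have hsplit : (u / ϑ) ^ 2 * a - v ^ 2 =
      u ^ 2 * T / ϑ ^ 2 * (a / T - ϑ) + (u ^ 2 * T / ϑ - v ^ 2) := by field_simp; ring
  have hdev := abs_add_le (u ^ 2 * T / ϑ ^ 2 * (a / T - ϑ)) (u ^ 2 * T / ϑ - v ^ 2)
  rw [← hsplit] at hdev
  rw [mul_assoc 2 (_ / _), abs_mul 2, abs_two]
  linarith

lemma tendsto_measure_abs_remainder (hϑ : 0 < ϑ) (hI : ∀ T, 0 < T → 0 < I T)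
    (hIT : Tendsto (fun T => T / I T) atTop (𝓝 ϑ)) [∀ T, IsProbabilityMeasure (Q T ϑ)]
    (hℓ : ∀ᶠ T in atTop, ∀ u, |u| ≤ ϑ / 2 → ∀ x,
      |ℓ T (ϑ + u) x - u * S T x - A T x * (Real.log (1 + u / ϑ) - u / ϑ)| ≤ u ^ 2 * T * η T)
    (hη : Tendsto η atTop (𝓝 0)) (hA : ∀ᶠ T in atTop, MemLp (A T) 2 (Q T ϑ))
    (hA_mean : Tendsto (fun T => ∫ x, (A T x / T - ϑ) ^ 2 ∂(Q T ϑ)) atTop (𝓝 0))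
    (v : ℝ) {δ : ℝ} (hδ : 0 < δ) :
    Tendsto (fun T => Q T ϑ {x | δ ≤ |ℓ T (ϑ + v / √(I T)) x - v / √(I T) * S T x + v ^ 2 / 2|})
      atTop (𝓝 0) := by
  have hu2 := tendsto_div_sqrt_sq_mul hI hIT v
  have hu := tendsto_zero_of_tendsto_sq_mul hu2
  set u := fun T => v / √(I T)
  refine tendsto_measure_le_abs_of_abs_le_add
    (g := fun T => u T ^ 2 * T * η T + 2 * v ^ 2 * |u T / ϑ| + 2 * |u T ^ 2 * T / ϑ - v ^ 2|)
    (Z := fun T x => 2 * (u T ^ 2 * T / ϑ ^ 2) * (A T x / T - ϑ)) ?_ ?_ ?_ ?_ hδ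
  · have hu_small : ∀ᶠ T in atTop, |u T| ≤ ϑ / 2 :=
      hu.abs.eventually (ge_mem_nhds (by rw [abs_zero]; exact half_pos hϑ))
    filter_upwards [eventually_gt_atTop 0, hu_small, hℓ] with T hT huT hℓT x
    exact abs_remainder_le hϑ hT huT (hℓT _ huT x)
  · have h := ((hu2.mul hη).add ((hu.div_const ϑ).abs.const_mul (2 * v ^ 2))).add
      (((hu2.div_const ϑ).sub_const (v ^ 2)).abs.const_mul 2)
    simpa [mul_div_cancel_right₀ _ hϑ.ne'] using h
  · filter_upwards [hA] with T hAT
    simp only [mul_pow, div_eq_mul_inv (A T _)]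
    exact ((hAT.mul_const T⁻¹).sub (memLp_const ϑ)).integrable_sq.const_mul _
  · have h := (((hu2.div_const (ϑ ^ 2)).const_mul 2).pow 2).mul hA_mean
    rw [mul_zero] at h
    refine h.congr fun T => ?_
    rw [← integral_const_mul]
    exact integral_congr_ae (ae_of_all _ fun x => (mul_pow _ _ 2).symm)

theorem isLAN_of_abs_sub_le {Θ : Set ℝ} (hϑ : 0 < ϑ) (hI : ∀ T, 0 < T → 0 < I T)
    (hIT : Tendsto (fun T => T / I T) atTop (𝓝 ϑ)) (hQ : ∀ T, IsProbabilityMeasure (Q T ϑ))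
    (hS : ∀ T, Measurable (S T)) (hℓ_meas : ∀ T ϑ', Measurable (ℓ T ϑ'))
    (hS_lim : TendstoInDistribution (fun T x => (√(I T))⁻¹ * S T x) atTop (id : ℝ → ℝ)
      (fun T => Q T ϑ) (gaussianReal 0 1))
    (hℓ_rnDeriv : ∀ T, 0 < T → ∀ ϑ' ∈ Θ, Q T ϑ' ≪ Q T ϑ ∧
      ∀ᵐ x ∂(Q T ϑ), ((Q T ϑ').rnDeriv (Q T ϑ) x).toReal = Real.exp (ℓ T ϑ' x))
    (hℓ : ∀ᶠ T in atTop, ∀ u, |u| ≤ ϑ / 2 → ∀ x,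
      |ℓ T (ϑ + u) x - u * S T x - A T x * (Real.log (1 + u / ϑ) - u / ϑ)| ≤ u ^ 2 * T * η T)
    (hη : Tendsto η atTop (𝓝 0)) (hA : ∀ᶠ T in atTop, MemLp (A T) 2 (Q T ϑ))
    (hA_mean : Tendsto (fun T => ∫ x, (A T x / T - ϑ) ^ 2 ∂(Q T ϑ)) atTop (𝓝 0)) :
    IsLAN Q Θ ϑ I := by
  refine ⟨hI, hQ, fun T x => (√(I T))⁻¹ * S T x, fun T => (hS T).const_mul _, hS_lim, fun v =>
    ⟨fun T x => ℓ T (ϑ + v / √(I T)) x - v / √(I T) * S T x + v ^ 2 / 2,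
      fun T => ((hℓ_meas T _).sub ((hS T).const_mul _)).add_const _, fun T hT hmem => ?_,
      fun δ hδ => tendsto_measure_abs_remainder hϑ hI hIT hℓ hη hA hA_mean v hδ⟩⟩
  obtain ⟨hac, hrn⟩ := hℓ_rnDeriv T hT _ hmem
  refine ⟨hac, hrn.mono fun x hx => ?_⟩
  rw [hx]
  congr 1
  ring

end LANCriterion

section CharacteristicFunctions

/-- The first-order Taylor remainder `e^{iy} - 1 - iy`: the integrand through which a centred
variable enters its characteristic function. -/
noncomputable def expRemainder (y : ℝ) : ℂ :=
  Complex.exp (y * Complex.I) - 1 - y * Complex.I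

lemma norm_expRemainder_le (y : ℝ) : ‖expRemainder y‖ ≤ 3 * y ^ 2 := by
  have hnorm : ‖(y : ℂ) * Complex.I‖ = |y| := by simp
  rw [expRemainder]
  by_cases hy : |y| ≤ 1
  · have hle := Complex.norm_exp_sub_one_sub_id_le (hnorm.trans_le hy)
    rw [hnorm, sq_abs] at hle
    nlinarith [sq_nonneg y]
  · have htri := norm_sub_le (Complex.exp (y * Complex.I) - 1) (y * Complex.I)
    have htri' := norm_sub_le (Complex.exp (y * Complex.I)) 1
    rw [Complex.norm_exp_ofReal_mul_I, norm_one] at htri'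
    rw [hnorm] at htri
    nlinarith [sq_abs y]

variable {ι : Type*} {l : Filter ι}

lemma tendsto_mul_expRemainder {T y : ι → ℝ} {b : ℝ} (hy : Tendsto y l (𝓝 0))
    (hb : Tendsto (fun i => y i ^ 2 * T i) l (𝓝 b)) :
    Tendsto (fun i => (T i : ℂ) * expRemainder (y i)) l (𝓝 (-(b : ℂ) / 2)) := by
  have hyI : Tendsto (fun i => (y i : ℂ) * Complex.I) l (𝓝 0) := by
    simpa using ((Complex.continuous_ofReal.tendsto 0).comp hy).mul_const Complex.I
  have hbC : Tendsto (fun i => (T i : ℂ) * (y i * Complex.I) ^ 2) l (𝓝 (-b)) := by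
    refine ((Complex.continuous_ofReal.tendsto b).comp hb).neg.congr fun i => ?_
    simp only [Function.comp_apply, mul_pow, Complex.I_sq]
    push_cast
    ring
  have hrest := (isLittleO_one_iff ℂ).mp (((isBigO_refl (fun i => (T i : ℂ)) l).mul_isLittleO
    ((Complex.exp_sub_sum_range_succ_isLittleO_pow 2).comp_tendsto hyI)).trans_isBigO
      (hbC.isBigO_one ℂ))
  convert! hrest.add (hbC.div_const 2) using 2
  · simp only [Function.comp_apply, Finset.sum_range_succ, Finset.sum_range_zero, expRemainder]
    norm_num
    ring
  · ring

lemma tendsto_one_add_pow_exp_of_tendsto_mul {n : ι → ℕ} {g : ι → ℂ} {c : ℂ}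
    (hg : Tendsto g l (𝓝 0)) (hc : Tendsto (fun i => n i * g i) l (𝓝 c)) :
    Tendsto (fun i => (1 + g i) ^ n i) l (𝓝 (Complex.exp c)) := by
  have hlog : Tendsto (fun i => n i * Complex.log (1 + g i)) l (𝓝 c) := by
    have hrest := ((isBigO_refl (fun i => (n i : ℂ)) l).mul
      (Complex.log_sub_self_isBigO.comp_tendsto hg)).trans_tendsto
      (by simpa [sq, mul_assoc] using hc.mul hg)
    refine (hrest.add hc).congr' ?_ |>.trans_eq (by rw [zero_add])
    exact .of_forall fun i => by simp only [Function.comp_apply]; ring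
  refine ((Complex.continuous_exp.tendsto c).comp hlog).congr' ?_
  filter_upwards [hg.eventually_ne (neg_ne_zero.mpr one_ne_zero).symm] with i hi
  rw [Function.comp_apply, Complex.exp_nat_mul, Complex.exp_log]
  rwa [Ne, add_comm, add_eq_zero_iff_eq_neg]

lemma charFun_map_eq_one_add_integral {Ω : Type*} [MeasurableSpace Ω] {μ : Measure Ω}
    [IsProbabilityMeasure μ] {X : Ω → ℝ} (hX : Integrable X μ) (hX₀ : ∫ ω, X ω ∂μ = 0) (t : ℝ) :
    charFun (μ.map X) t = 1 + ∫ ω, expRemainder (t * X ω) ∂μ := by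
  have hexp : Integrable (fun ω => Complex.exp ((t * X ω : ℝ) * Complex.I)) μ :=
    .of_bound (C := 1) (by have := hX.aestronglyMeasurable.aemeasurable; fun_prop)
      (ae_of_all _ fun ω => (Complex.norm_exp_ofReal_mul_I _).le)
  have hlin : Integrable (fun ω => ((t * X ω : ℝ) : ℂ) * Complex.I) μ :=
    (hX.const_mul t).ofReal.mul_const _
  have hlin₀ : ∫ ω, ((t * X ω : ℝ) : ℂ) * Complex.I ∂μ = 0 := by
    rw [integral_mul_const, integral_complex_ofReal, integral_const_mul, hX₀]
    simp
  simp only [expRemainder]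
  rw [integral_sub (f := fun ω => Complex.exp ((t * X ω : ℝ) * Complex.I) - 1)
    (hexp.sub (integrable_const _)) hlin, integral_sub hexp (integrable_const _),
    hlin₀, charFun_apply_real, integral_map hX.aemeasurable (by fun_prop)]
  simp

theorem tendstoInDistribution_gaussianReal {𝓧 : ℝ → Type*} [∀ T, MeasurableSpace (𝓧 T)]
    {μ : ∀ T, Measure (𝓧 T)} [∀ T, IsProbabilityMeasure (μ T)] {ξ : ∀ T, 𝓧 T → ℝ}
    (hξ : ∀ T, Measurable (ξ T))
    (h : ∀ s : ℝ, Tendsto (fun T => charFun ((μ T).map (ξ T)) s) atTop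
      (𝓝 (Complex.exp (-(s ^ 2 : ℝ) / 2)))) :
    TendstoInDistribution ξ atTop (id : ℝ → ℝ) μ (gaussianReal 0 1) where
  forall_aemeasurable T := (hξ T).aemeasurable
  aemeasurable_limit := aemeasurable_id
  tendsto := by
    refine tendsto_of_seq_tendsto fun u hu =>
      ProbabilityMeasure.tendsto_of_tendsto_charFun fun s => ?_
    convert! (h s).comp hu using 2
    rw [ProbabilityMeasure.coe_mk, Measure.map_id, charFun_gaussianReal]
    congr 1
    push_cast
    ring

end CharacteristicFunctions

section Microscopic

variable {ϑ : ℝ} {D : ℝ → ℝ}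

lemma tendsto_nhdsGT_zero_of_pos (hD : ∀ T, 0 < T → 0 < D T) (hD₀ : Tendsto D atTop (𝓝 0)) :
    Tendsto D atTop (𝓝[>] 0) :=
  tendsto_nhdsWithin_iff.mpr ⟨hD₀, (eventually_gt_atTop 0).mono hD⟩

lemma tendsto_floor_div_mul_div (hD : Tendsto D atTop (𝓝[>] 0)) :
    Tendsto (fun T => (⌊T / D T⌋₊ : ℝ) * D T / T) atTop (𝓝 1) := by
  have hD₀ := hD.mono_right nhdsWithin_le_nhds
  have hlower : Tendsto (fun T => 1 - D T / T) atTop (𝓝 1) := by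
    simpa using (hD₀.div_atTop tendsto_id).const_sub 1
  refine tendsto_of_tendsto_of_tendsto_of_le_of_le' hlower tendsto_const_nhds ?_ ?_ <;>
    filter_upwards [eventually_gt_atTop 0, hD.eventually self_mem_nhdsWithin] with T hT
      (hDT : 0 < D T)
  · have hlt := (Nat.lt_floor_add_one (T / D T)).le
    rw [div_le_iff₀ hDT] at hlt
    rw [le_div_iff₀ hT, sub_mul, div_mul_cancel₀ _ hT.ne']
    linarith
  · exact div_le_one_of_le₀
      ((le_div_iff₀ hDT).mp (Nat.floor_le (div_pos hT hDT).le)) hT.le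

variable {c : ℝ → ℝ} {b : ℝ}

lemma norm_mul_expRemainder_score_le {T Δ c : ℝ} (hT : 0 ≤ T) (k : ℤ) :
    ‖(T : ℂ) * expRemainder (c * score Δ ϑ k)‖ ≤ 3 * (c ^ 2 * T) * score Δ ϑ k ^ 2 := by
  rw [norm_mul, Complex.norm_real, Real.norm_of_nonneg hT]
  nlinarith [norm_expRemainder_le (c * score Δ ϑ k)]

theorem tendsto_inv_smul_integral_expRemainder_score (hϑ : 0 < ϑ) (hD : Tendsto D atTop (𝓝[>] 0))
    (hc : Tendsto (fun T => c T ^ 2 * T) atTop (𝓝 b)) :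
    Tendsto (fun T => (D T)⁻¹ • ∫ k, (T : ℂ) * expRemainder (c T * score (D T) ϑ k)
      ∂skellamMeasure (ϑ * D T)) atTop (𝓝 (-(b / ϑ : ℝ) / 2)) := by
  have hpos := eventually_pos_and_le_one hD
  have hunit {k : ℤ} (hk : |(k : ℝ)| = 1) :
      Tendsto (fun T : ℝ => (T : ℂ) * expRemainder (c T * score (D T) ϑ k)) atTop
        (𝓝 (-(b / ϑ ^ 2 : ℝ) / 2)) := by
    have hscore := tendsto_score hϑ hD k
    rw [hk] at hscore
    refine tendsto_mul_expRemainder ?_ ?_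
    · simpa using (tendsto_zero_of_tendsto_sq_mul hc).mul hscore
    · convert! hc.mul (hscore.pow 2) using 2 <;> ring
  convert! tendsto_inv_smul_integral_increment hϑ hD
    (f := fun (T : ℝ) k => (T : ℂ) * expRemainder (c T * score (D T) ϑ k))
    (C := 3 * (b + 1) * (1 / ϑ + 1 * (1 + ϑ * 1)) ^ 2) ?_ ?_
    (hunit (k := 1) (by simp)) (hunit (k := -1) (by simp)) using 2
  · rw [Complex.real_smul]
    push_cast
    field_simp
    ring
  · filter_upwards [eventually_gt_atTop 0, hpos, hc.eventually (ge_mem_nhds (lt_add_one b))]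
      with T hT ⟨hDT, hDT₁⟩ hcT k
    have hb : 0 ≤ b + 1 := (by positivity : 0 ≤ c T ^ 2 * T).trans hcT
    have hscore := norm_score_sq_le hϑ hDT k
    rw [Real.norm_of_nonneg (sq_nonneg _)] at hscore
    calc _ ≤ _ := norm_mul_expRemainder_score_le hT.le k
      _ ≤ 3 * (b + 1) * ((1 / ϑ + D T * (1 + ϑ * D T)) ^ 2 * Real.exp (2 * k.natAbs)) := by
        gcongr
      _ ≤ _ := by rw [← mul_assoc]; gcongr
  · refine squeeze_zero_norm' (a := fun T => 3 * (c T ^ 2 * T) *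
      ((D T)⁻¹ * score (D T) ϑ 0 ^ 2)) ?_ ?_
    · filter_upwards [eventually_gt_atTop 0, hpos] with T hT ⟨hDT, _⟩
      rw [norm_smul, Real.norm_of_nonneg (inv_nonneg.mpr hDT.le), mul_left_comm]
      gcongr
      exact norm_mul_expRemainder_score_le hT.le 0
    · simpa using (hc.const_mul 3).mul (tendsto_inv_mul_score_zero_sq hϑ hD)

theorem tendsto_charFun_score_pow (hϑ : 0 < ϑ) (hD : Tendsto D atTop (𝓝[>] 0))
    (hc : Tendsto (fun T => c T ^ 2 * T) atTop (𝓝 b)) :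
    Tendsto (fun T => charFun ((skellamMeasure (ϑ * D T)).map (score (D T) ϑ)) (c T) ^
      ⌊T / D T⌋₊) atTop (𝓝 (Complex.exp (-(b / ϑ : ℝ) / 2))) := by
  have hmain := tendsto_inv_smul_integral_expRemainder_score hϑ hD hc
  have hpos := (eventually_gt_atTop (0 : ℝ)).and (eventually_pos_and_le_one hD)
  set g : ℝ → ℂ := fun T => ∫ k, expRemainder (c T * score (D T) ϑ k) ∂skellamMeasure (ϑ * D T)
  have hmain : Tendsto (fun T => (D T)⁻¹ • ((T : ℂ) * g T)) atTop (𝓝 (-(b / ϑ : ℝ) / 2)) := by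
    simpa only [integral_const_mul] using hmain
  have hscale {a : ℝ → ℝ} {x : ℝ} (ha : Tendsto (fun T => a T * D T / T) atTop (𝓝 x)) :
      Tendsto (fun T => (a T : ℂ) * g T) atTop (𝓝 (x * (-(b / ϑ : ℝ) / 2))) := by
    refine (((Complex.continuous_ofReal.tendsto x).comp ha).mul hmain).congr' ?_
    filter_upwards [hpos] with T ⟨hT, hDT, _⟩
    have : (D T : ℂ) ≠ 0 := mod_cast hDT.ne'
    have : (T : ℂ) ≠ 0 := mod_cast hT.ne'
    rw [Function.comp_apply, Complex.real_smul, Complex.ofReal_div, Complex.ofReal_mul,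
      Complex.ofReal_inv]
    field_simp
  have hg : Tendsto g atTop (𝓝 0) := by
    simpa using hscale (a := fun _ => 1) (x := 0)
      (by simpa using (hD.mono_right nhdsWithin_le_nhds).div_atTop tendsto_id)
  have hfloor := hscale (tendsto_floor_div_mul_div hD)
  rw [Complex.ofReal_one, one_mul] at hfloor
  refine (tendsto_one_add_pow_exp_of_tendsto_mul hg (by exact_mod_cast hfloor)).congr' ?_
  filter_upwards [hpos] with T ⟨_, hDT, _⟩
  rw [charFun_map_eq_one_add_integral ((memLp_score hϑ hDT).integrable one_le_two)
    (integral_score hϑ hDT)]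

end Microscopic

section ProductMeasures

variable {α : Type*} [MeasurableSpace α] {κ : Measure α} [IsProbabilityMeasure κ] {f : α → ℝ}
  {n : ℕ}

lemma charFun_map_sum_comp_pi (hf : Measurable f) (t : ℝ) :
    charFun ((Measure.pi fun _ : Fin n => κ).map fun y => ∑ j, f (y j)) t =
      charFun (κ.map f) t ^ n := by
  have hindep : iIndepFun (fun j (y : Fin n → α) => f (y j)) (Measure.pi fun _ => κ) :=
    iIndepFun_pi fun _ => hf.aemeasurable
  have hmeas (j : Fin n) : AEMeasurable (fun y : Fin n → α => f (y j)) (Measure.pi fun _ => κ) :=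
    (hf.comp (measurable_pi_apply j)).aemeasurable
  rw [hindep.charFun_map_fun_sum_eq_prod hmeas, Finset.prod_apply]
  have hmap (j : Fin n) : (Measure.pi fun _ : Fin n => κ).map (fun y => f (y j)) = κ.map f := by
    exact (Measure.map_map hf (measurable_pi_apply j)).symm.trans
      (by rw [(measurePreserving_eval (fun _ : Fin n => κ) j).map_eq])
  simp [hmap]

lemma memLp_sum_comp_eval (hf : MemLp f 2 κ) :
    MemLp (fun y : Fin n → α => ∑ j, f (y j)) 2 (Measure.pi fun _ => κ) :=
  memLp_finsetSum _ fun j _ => hf.comp_measurePreserving (measurePreserving_eval _ j)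

lemma integral_sum_comp_eval_sub_sq_le (hf : MemLp f 2 κ) (a : ℝ) :
    ∫ y : Fin n → α, (∑ j, f (y j) - a) ^ 2 ∂(Measure.pi fun _ => κ) ≤
      n * ∫ x, f x ^ 2 ∂κ + (n * ∫ x, f x ∂κ - a) ^ 2 := by
  have hvar := variance_sum_pi (ι := Fin n) (μ := fun _ => κ) (X := fun _ => f) fun _ => hf
  have hmean : ∫ y : Fin n → α, ∑ j, f (y j) ∂(Measure.pi fun _ => κ) = n * ∫ x, f x ∂κ := by
    rw [integral_finsetSum]
    · simp [integral_comp_eval (X := fun _ : Fin n => α) (μ := fun _ => κ) hf.aestronglyMeasurable]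
    · exact fun j _ =>
        (hf.comp_measurePreserving (measurePreserving_eval _ j)).integrable one_le_two
  rw [integral_sub_const_sq (memLp_sum_comp_eval hf), hmean,
    show (fun y : Fin n → α => ∑ j, f (y j)) = ∑ j, fun y => f (y j) by ext; simp, hvar]
  simp only [Finset.sum_const, Finset.card_univ, Fintype.card_fin, nsmul_eq_mul]
  gcongr
  exact variance_le_expectation_sq hf.aestronglyMeasurable

end ProductMeasures

section ObservationLAN

variable {ϑ : ℝ} {D : ℝ → ℝ}

theorem tendsto_integral_sum_abs_div_sub_sq (hϑ : 0 < ϑ) (hD : Tendsto D atTop (𝓝[>] 0)) :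
    Tendsto (fun T => ∫ y : Fin ⌊T / D T⌋₊ → ℤ, ((∑ j, |(y j : ℝ)|) / T - ϑ) ^ 2
      ∂(Measure.pi fun _ => skellamMeasure (ϑ * D T))) atTop (𝓝 0) := by
  have hn := tendsto_floor_div_mul_div hD
  have hvar := (tendsto_inv_atTop_zero.mul hn).mul (tendsto_integral_abs_sq hϑ hD)
  have hmean := ((hn.mul (tendsto_integral_abs hϑ hD)).sub_const ϑ).pow 2
  have hbound := hvar.add hmean
  rw [zero_mul, zero_mul, one_mul, sub_self, zero_pow two_ne_zero, zero_add] at hbound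
  refine squeeze_zero' (.of_forall fun T => integral_nonneg fun y => sq_nonneg _) ?_ hbound
  filter_upwards [eventually_gt_atTop 0, eventually_pos_and_le_one hD] with T hT ⟨hDT, _⟩
  have hle := integral_sum_comp_eval_sub_sq_le (n := ⌊T / D T⌋₊)
    (memLp_abs (mul_pos hϑ hDT).le) (T * ϑ)
  calc _ = (T ^ 2)⁻¹ * ∫ y : Fin ⌊T / D T⌋₊ → ℤ, (∑ j, |(y j : ℝ)| - T * ϑ) ^ 2
        ∂(Measure.pi fun _ => skellamMeasure (ϑ * D T)) := by
        rw [← integral_const_mul]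
        congr with y
        field_simp
    _ ≤ _ := mul_le_mul_of_nonneg_left hle (by positivity)
    _ = _ := by field_simp

lemma abs_log_skellamProb_sub_le {u Δ : ℝ} (hϑ : 0 < ϑ) (hϑu : 0 < ϑ + u) (hu : |u| ≤ ϑ)
    (hΔ : 0 < Δ) (hΔ₁ : Δ ≤ 1) (k : ℤ) :
    |Real.log (skellamProb ((ϑ + u) * Δ) k) - Real.log (skellamProb (ϑ * Δ) k) -
      u * score Δ ϑ k - |(k : ℝ)| * (Real.log (1 + u / ϑ) - u / ϑ)| ≤
      u ^ 2 * Δ ^ 2 * (ϑ ^ 2 + 1) := by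
  have hlog : Real.log ((ϑ + u) * Δ / 2) = Real.log (ϑ * Δ / 2) + Real.log (1 + u / ϑ) := by
    have hratio : 1 + u / ϑ = (ϑ + u) / ϑ := by field_simp
    rw [hratio, ← Real.log_mul (by positivity) (by positivity)]
    congr 1
    field_simp
  have hseries := abs_log_besselSeries_sub_le (k := k.natAbs) (sq_nonneg (ϑ * Δ / 2))
    (sq_nonneg ((ϑ + u) * Δ / 2))
  have hslope₀ := besselSlope_nonneg (k := k.natAbs) (sq_nonneg (ϑ * Δ / 2))
  have hslope₁ := besselSlope_le_one (k := k.natAbs) (sq_nonneg (ϑ * Δ / 2))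
  rw [log_skellamProb (mul_pos hϑu hΔ), log_skellamProb (mul_pos hϑ hΔ), score_eq hϑ hΔ, hlog,
    Nat.cast_natAbs, Int.cast_abs]
  set b := besselSlope k.natAbs ((ϑ * Δ / 2) ^ 2)
  set g' := Real.log (besselSeries k.natAbs (((ϑ + u) * Δ / 2) ^ 2))
  set g := Real.log (besselSeries k.natAbs ((ϑ * Δ / 2) ^ 2))
  have hsq : (((ϑ + u) * Δ / 2) ^ 2 - (ϑ * Δ / 2) ^ 2) ^ 2 ≤ u ^ 2 * Δ ^ 2 * ϑ ^ 2 := by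
    have hfactor : ((ϑ + u) * Δ / 2) ^ 2 - (ϑ * Δ / 2) ^ 2 =
        u * Δ * (Δ * ((2 * ϑ + u) / 4)) := by ring
    have hu₂ := (abs_le.mp hu).2
    have h₀ : 0 ≤ (2 * ϑ + u) / 4 := by linarith
    rw [hfactor, mul_pow, mul_pow]
    gcongr
    calc Δ * ((2 * ϑ + u) / 4) ≤ 1 * ((2 * ϑ + u) / 4) := by gcongr
      _ ≤ ϑ := by linarith
  have hsplit : -((ϑ + u) * Δ) + |(k : ℝ)| * (Real.log (ϑ * Δ / 2) + Real.log (1 + u / ϑ)) + g' -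
      (-(ϑ * Δ) + |(k : ℝ)| * Real.log (ϑ * Δ / 2) + g) -
      u * (|(k : ℝ)| / ϑ + Δ * (ϑ * Δ / 2 * b - 1)) -
      |(k : ℝ)| * (Real.log (1 + u / ϑ) - u / ϑ) =
      (g' - g - (((ϑ + u) * Δ / 2) ^ 2 - (ϑ * Δ / 2) ^ 2) * b) + u ^ 2 * Δ ^ 2 * (b / 4) := by ring
  have hslope : |u ^ 2 * Δ ^ 2 * (b / 4)| ≤ u ^ 2 * Δ ^ 2 * 1 := by
    rw [abs_of_nonneg (by positivity)]
    gcongr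
    linarith
  calc _ ≤ _ := hsplit ▸ abs_add_le _ _
    _ ≤ u ^ 2 * Δ ^ 2 * ϑ ^ 2 + u ^ 2 * Δ ^ 2 * 1 := add_le_add (hseries.trans hsq) hslope
    _ = _ := by ring

variable {Ω : Type*} [MeasurableSpace Ω]

lemma information_eq_mul (P : Measure Ω) (X : ℝ≥0 → Ω → ℤ) (ϑ T Δ : ℝ) :
    information P X ϑ T Δ = T * information P X ϑ 1 Δ := by
  simp only [information, one_mul, mul_assoc]

variable {P : Measure Ω} {N : ℝ≥0 → Ω → ℕ} {ε : ℕ → Ω → ℤ}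

lemma IsModel.information_eq (h : IsModel P ϑ N ε) (hϑ : 0 ≤ ϑ) (T : ℝ) {Δ : ℝ} (hΔ : 0 < Δ) :
    information P (compound N ε) ϑ T Δ =
      T * (Δ⁻¹ * ∫ k, score Δ ϑ k ^ 2 ∂skellamMeasure (ϑ * Δ)) := by
  have hlaw := h.map_compound hϑ Δ.toNNReal
  rw [Real.coe_toNNReal Δ hΔ.le] at hlaw
  rw [← hlaw, integral_map (h.measurable_compound _).aemeasurable
    (Measurable.of_discrete).aestronglyMeasurable]
  simp only [score, mul_pow]
  rw [integral_const_mul, information]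
  field_simp

lemma IsModel.information_pos (h : IsModel P ϑ N ε) (hϑ : 0 < ϑ) {T Δ : ℝ} (hT : 0 < T)
    (hΔ : 0 < Δ) : 0 < information P (compound N ε) ϑ T Δ := by
  rw [h.information_eq hϑ.le T hΔ]
  have := integral_score_sq_pos hϑ hΔ
  positivity

theorem IsModel.tendsto_information (h : IsModel P ϑ N ε) (hϑ : 0 < ϑ) {ι : Type*} {l : Filter ι}
    {D : ι → ℝ} (hD : Tendsto D l (𝓝[>] 0)) (T : ℝ) :
    Tendsto (fun i => information P (compound N ε) ϑ T (D i)) l (𝓝 (T / ϑ)) := by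
  rw [← mul_one_div]
  refine ((tendsto_integral_score_sq hϑ hD).const_mul T).congr' ?_
  filter_upwards [hD.eventually self_mem_nhdsWithin] with i hi
  rw [h.information_eq hϑ.le T hi]

lemma IsModel.tendsto_div_information (h : IsModel P ϑ N ε) (hϑ : 0 < ϑ)
    (hD : Tendsto D atTop (𝓝[>] 0)) :
    Tendsto (fun T => T / information P (compound N ε) ϑ T (D T)) atTop (𝓝 ϑ) := by
  have hinv := (h.tendsto_information hϑ hD 1).inv₀ (one_div_pos.mpr hϑ).ne'
  rw [one_div, inv_inv] at hinv
  refine hinv.congr' ?_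
  filter_upwards [eventually_gt_atTop 0] with T hT
  rw [information_eq_mul P _ ϑ T, div_mul_eq_div_div, div_self hT.ne', one_div]

theorem IsModel.isEquivalent_information (h : IsModel P ϑ N ε) (hϑ : 0 < ϑ)
    (hD : Tendsto D atTop (𝓝[>] 0)) :
    (fun T => information P (compound N ε) ϑ T (D T)) ~[atTop] fun T => T / ϑ := by
  have hlim := (h.tendsto_information hϑ hD 1).mul_const ϑ
  rw [one_div_mul_cancel hϑ.ne'] at hlim
  refine (isEquivalent_iff_tendsto_one ?_).mpr (hlim.congr' ?_)
  · filter_upwards [eventually_gt_atTop 0] with T hT using (div_pos hT hϑ).ne'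
  · filter_upwards [eventually_gt_atTop 0] with T hT
    rw [Pi.div_apply, information_eq_mul P _ ϑ T]
    field_simp

theorem IsModel.tendsto_charFun_sum_score (h : IsModel P ϑ N ε) (hϑ : 0 < ϑ)
    (hD : ∀ T, 0 < T → 0 < D T) (hD₀ : Tendsto D atTop (𝓝 0)) (s : ℝ) :
    Tendsto (fun T => charFun ((observationLaw P (compound N ε) T (D T)).map fun z =>
      (√(information P (compound N ε) ϑ T (D T)))⁻¹ * ∑ j, score (D T) ϑ (increments z j)) s)
      atTop (𝓝 (Complex.exp (-(s ^ 2 : ℝ) / 2))) := by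
  have hD' := tendsto_nhdsGT_zero_of_pos hD hD₀
  have hc := tendsto_div_sqrt_sq_mul (fun T hT => h.information_pos hϑ hT (hD T hT))
    (h.tendsto_div_information hϑ hD') s
  have hlim := tendsto_charFun_score_pow hϑ hD' hc
  rw [mul_div_cancel_right₀ _ hϑ.ne'] at hlim
  refine hlim.congr' ?_
  filter_upwards [eventually_gt_atTop 0] with T hT
  have hlaw := h.map_increments_observationLaw hϑ.le T (hD T hT).le
  rw [← charFun_map_sum_comp_pi .of_discrete, ← hlaw, Measure.map_map .of_discrete .of_discrete,
    charFun_map_mul_comp (Measurable.of_discrete).aemeasurable, div_eq_inv_mul s]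
  rfl

lemma IsModel.rnDeriv_observationLaw {P' : Measure Ω} {ϑ' Δ : ℝ} {N' : ℝ≥0 → Ω → ℕ}
    {ε' : ℕ → Ω → ℤ} (h : IsModel P ϑ N ε) (h' : IsModel P' ϑ' N' ε') (hϑ : 0 < ϑ) (hϑ' : 0 < ϑ')
    (T : ℝ) (hΔ : 0 < Δ) :
    observationLaw P' (compound N' ε') T Δ ≪ observationLaw P (compound N ε) T Δ ∧
      ∀ z, ((observationLaw P' (compound N' ε') T Δ).rnDeriv
        (observationLaw P (compound N ε) T Δ) z).toReal =
          Real.exp (∑ j, (Real.log (skellamProb (ϑ' * Δ) (increments z j)) -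
            Real.log (skellamProb (ϑ * Δ) (increments z j)))) := by
  have := h.isProbabilityMeasure_observationLaw T Δ
  have := h'.isProbabilityMeasure_observationLaw T Δ
  have hpos {ϑ : ℝ} (hϑ : 0 < ϑ) (k : ℤ) := skellamProb_pos (mul_pos hϑ hΔ) k
  have hprod (z) : 0 < (observationLaw P (compound N ε) T Δ).real {z} := by
    rw [h.observationLaw_real_singleton hϑ.le hΔ.le]
    exact Finset.prod_pos fun j _ => hpos hϑ _
  have hac : observationLaw P' (compound N' ε') T Δ ≪ observationLaw P (compound N ε) T Δ :=
    absolutelyContinuous_of_measureReal_singleton_pos hprod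
  refine ⟨hac, fun z => ?_⟩
  rw [eq_div_of_mul_eq (hprod z).ne' (toReal_rnDeriv_mul_measureReal_singleton hac z),
    h.observationLaw_real_singleton hϑ.le hΔ.le, h'.observationLaw_real_singleton hϑ'.le hΔ.le,
    ← Finset.prod_div_distrib, Real.exp_sum]
  simp_rw [Real.exp_sub, Real.exp_log (hpos hϑ _), Real.exp_log (hpos hϑ' _)]

lemma abs_sum_log_skellamProb_sub_le {u T Δ : ℝ} (hϑ : 0 < ϑ) (hϑu : 0 < ϑ + u) (hu : |u| ≤ ϑ)
    (hT : 0 ≤ T) (hΔ : 0 < Δ) (hΔ₁ : Δ ≤ 1) (k : Fin ⌊T / Δ⌋₊ → ℤ) :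
    |∑ j, (Real.log (skellamProb ((ϑ + u) * Δ) (k j)) - Real.log (skellamProb (ϑ * Δ) (k j))) -
      u * ∑ j, score Δ ϑ (k j) - (∑ j, |(k j : ℝ)|) * (Real.log (1 + u / ϑ) - u / ϑ)| ≤
      u ^ 2 * T * (Δ * (ϑ ^ 2 + 1)) := by
  have hfloor : ⌊T / Δ⌋₊ * Δ ≤ T := (le_div_iff₀ hΔ).mp (Nat.floor_le (by positivity))
  rw [Finset.mul_sum, Finset.sum_mul, ← Finset.sum_sub_distrib, ← Finset.sum_sub_distrib]
  calc _ ≤ ∑ _j : Fin ⌊T / Δ⌋₊, u ^ 2 * Δ ^ 2 * (ϑ ^ 2 + 1) :=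
        (Finset.abs_sum_le_sum_abs _ _).trans <| Finset.sum_le_sum fun j _ =>
          abs_log_skellamProb_sub_le hϑ hϑu hu hΔ hΔ₁ (k j)
    _ = (⌊T / Δ⌋₊ * Δ) * (u ^ 2 * Δ * (ϑ ^ 2 + 1)) := by
        rw [Finset.sum_const, Finset.card_univ, Fintype.card_fin, nsmul_eq_mul]
        ring
    _ ≤ T * (u ^ 2 * Δ * (ϑ ^ 2 + 1)) := by gcongr
    _ = _ := by ring

theorem isLAN_observationLaw {Θ : Set ℝ} {P : ℝ → Measure Ω} {N : ℝ → ℝ≥0 → Ω → ℕ}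
    {ε : ℝ → ℕ → Ω → ℤ} (hΘ : Θ ⊆ Set.Ioi 0) (h : ∀ ϑ ∈ Θ, IsModel (P ϑ) ϑ (N ϑ) (ε ϑ))
    (hD : ∀ T, 0 < T → 0 < D T) (hD₀ : Tendsto D atTop (𝓝 0)) (hϑΘ : ϑ ∈ Θ) :
    IsLAN (fun T ϑ' => observationLaw (P ϑ') (compound (N ϑ') (ε ϑ')) T (D T)) Θ ϑ
      (fun T => information (P ϑ) (compound (N ϑ) (ε ϑ)) ϑ T (D T)) := by
  have hϑ : 0 < ϑ := hΘ hϑΘ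
  have hmodel := h ϑ hϑΘ
  have hD' := tendsto_nhdsGT_zero_of_pos hD hD₀
  have hQ (T : ℝ) := hmodel.isProbabilityMeasure_observationLaw T (D T)
  have hlaw {T : ℝ} (hT : 0 < T) := hmodel.map_increments_observationLaw hϑ.le T (hD T hT).le
  refine isLAN_of_abs_sub_le
    (S := fun T z => ∑ j, score (D T) ϑ (increments z j))
    (A := fun T z => ∑ j, |(increments z j : ℝ)|)
    (ℓ := fun T ϑ' z => ∑ j, (Real.log (skellamProb (ϑ' * D T) (increments z j)) -
      Real.log (skellamProb (ϑ * D T) (increments z j))))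
    (η := fun T => D T * (ϑ ^ 2 + 1)) hϑ
    (fun T hT => hmodel.information_pos hϑ hT (hD T hT)) (hmodel.tendsto_div_information hϑ hD')
    hQ (fun _ => .of_discrete) (fun _ _ => .of_discrete)
    (tendstoInDistribution_gaussianReal (fun _ => .of_discrete)
      (hmodel.tendsto_charFun_sum_score hϑ hD hD₀)) (fun T hT ϑ' hϑ' => ?_) ?_
    (by simpa using hD₀.mul_const (ϑ ^ 2 + 1)) ?_ ?_
  · have hrn := hmodel.rnDeriv_observationLaw (h ϑ' hϑ') hϑ (hΘ hϑ') T (hD T hT)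
    exact ⟨hrn.1, ae_of_all _ hrn.2⟩
  · filter_upwards [eventually_gt_atTop 0, eventually_pos_and_le_one hD'] with T hT hDT u hu z
    exact abs_sum_log_skellamProb_sub_le hϑ (by linarith [(abs_le.mp hu).1]) (by linarith) hT.le
      hDT.1 hDT.2 _
  · filter_upwards [eventually_gt_atTop 0] with T hT
    have hmem := memLp_sum_comp_eval (n := ⌊T / D T⌋₊) (memLp_abs (mul_pos hϑ (hD T hT)).le)
    rw [← hlaw hT] at hmem
    exact hmem.comp_of_map (Measurable.of_discrete).aemeasurable
  · refine (tendsto_integral_sum_abs_div_sub_sq hϑ hD').congr' ?_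
    filter_upwards [eventually_gt_atTop 0] with T hT
    rw [← hlaw hT, integral_map (Measurable.of_discrete).aemeasurable
      (Measurable.of_discrete).aestronglyMeasurable]

end ObservationLAN

section PoissonMoments

variable (r : ℝ≥0)

lemma charFun_map_sub_poissonMeasure (t : ℝ) :
    charFun ((poissonMeasure r).map fun n : ℕ => (n : ℝ) - r) t =
      Complex.exp (r * expRemainder t) := by
  have hmap : (poissonMeasure r).map (fun n : ℕ => (n : ℝ) - r) =
      ((poissonMeasure r).map fun n : ℕ => (n : ℝ)).map (· + -(r : ℝ)) :=
    (Measure.map_map (measurable_add_const (-(r : ℝ))) .of_discrete).symm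
  rw [hmap, charFun_map_add_const, charFun_map_cast_poissonMeasure, ← Complex.exp_add, expRemainder]
  congr 1
  simp
  ring

lemma hasSum_poissonMeasure_mul_id :
    HasSum (fun n : ℕ => Real.exp (-r) * r ^ n / n.factorial * n) r := by
  rw [← hasSum_nat_add_iff' 1]
  have h := (hasSum_one_poissonMeasure r).mul_left (r : ℝ)
  convert! h using 1
  · ext n
    rw [Nat.factorial_succ, pow_succ]
    push_cast
    field_simp
  · simp

lemma hasSum_poissonMeasure_mul_descPochhammer :
    HasSum (fun n : ℕ => Real.exp (-r) * r ^ n / n.factorial * (n * (n - 1))) ((r : ℝ) ^ 2) := by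
  rw [← hasSum_nat_add_iff' 1]
  have h := (hasSum_poissonMeasure_mul_id r).mul_left (r : ℝ)
  convert! h using 1
  · ext n
    rw [Nat.factorial_succ, pow_succ]
    push_cast
    field_simp
    ring
  · simp [sq]

lemma hasSum_poissonMeasure_mul_sub_sq :
    HasSum (fun n : ℕ => Real.exp (-r) * r ^ n / n.factorial * ((n : ℝ) - r) ^ 2) r := by
  have h := ((hasSum_poissonMeasure_mul_descPochhammer r).add
    ((hasSum_poissonMeasure_mul_id r).mul_left (1 - 2 * (r : ℝ)))).add
    ((hasSum_one_poissonMeasure r).mul_left ((r : ℝ) ^ 2))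
  convert! h using 1
  · ext n
    ring
  · ring

lemma integral_sub_sq_poissonMeasure :
    ∫ n : ℕ, ((n : ℝ) - r) ^ 2 ∂poissonMeasure r = r := by
  rw [integral_poissonMeasure]
  exact (hasSum_poissonMeasure_mul_sub_sq r).tsum_eq

lemma memLp_natCast_poissonMeasure : MemLp (fun n : ℕ => (n : ℝ)) 2 (poissonMeasure r) := by
  have hsq : MemLp (fun n : ℕ => (n : ℝ) - r) 2 (poissonMeasure r) := by
    rw [memLp_two_iff_integrable_sq .of_discrete, integrable_poissonMeasure_iff]
    simpa using (hasSum_poissonMeasure_mul_sub_sq r).summable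
  convert! hsq.add (memLp_const (r : ℝ)) using 1
  ext n
  simp

end PoissonMoments

section ChangeOfIntensity

lemma map_withDensity_comp {α β : Type*} [MeasurableSpace α] [MeasurableSpace β] {μ : Measure α}
    {f : α → β} {g : β → ℝ≥0∞} (hf : Measurable f) (hg : Measurable g) :
    (μ.withDensity (g ∘ f)).map f = (μ.map f).withDensity g := by
  ext s hs
  rw [Measure.map_apply hf hs, withDensity_apply _ (hf hs), withDensity_apply _ hs,
    setLIntegral_map hs hg hf]
  rfl

lemma partialSum_last {n : ℕ} (m : Fin n → ℕ) : Fin.partialSum m (Fin.last n) = ∑ j, m j := by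
  rw [Fin.partialSum, Fin.val_last, List.take_of_length_le (by simp), List.sum_ofFn]

lemma sum_succ_sub_castSucc {G : Type*} [AddCommGroup G] {n : ℕ} (f : Fin (n + 1) → G) :
    ∑ j : Fin n, (f j.succ - f j.castSucc) = f (Fin.last n) - f 0 := by
  rw [Finset.sum_sub_distrib, sub_eq_sub_iff_add_eq_add, add_comm, ← Fin.sum_univ_succ,
    Fin.sum_univ_castSucc, add_comm]

variable {ϑ ϑ' : ℝ}

lemma poissonMeasure_singleton_eq_mul (hϑ : 0 < ϑ) (hϑ' : 0 < ϑ') (δ : ℝ≥0) (m : ℕ) :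
    poissonMeasure (ϑ'.toNNReal * δ) {m} =
      ENNReal.ofReal (Real.exp (m * Real.log (ϑ' / ϑ) - (ϑ' - ϑ) * δ)) *
        poissonMeasure (ϑ.toNNReal * δ) {m} := by
  rw [poissonMeasure_singleton, poissonMeasure_singleton, ← ENNReal.ofReal_mul (Real.exp_pos _).le]
  congr 1
  have hpow : Real.exp (m * Real.log (ϑ' / ϑ)) = (ϑ' / ϑ) ^ m := by
    rw [Real.exp_nat_mul, Real.exp_log (by positivity)]
  have hexp : Real.exp (-(ϑ' * δ)) = Real.exp (-((ϑ' - ϑ) * δ)) * Real.exp (-(ϑ * δ)) := by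
    rw [← Real.exp_add]
    ring_nf
  push_cast
  rw [Real.coe_toNNReal _ hϑ.le, Real.coe_toNNReal _ hϑ'.le, sub_eq_add_neg, Real.exp_add, hpow,
    hexp, mul_pow, mul_pow, div_pow]
  field_simp

lemma pi_poissonMeasure_eq_withDensity (hϑ : 0 < ϑ) (hϑ' : 0 < ϑ') {n : ℕ} (δ : Fin n → ℝ≥0) :
    Measure.pi (fun j => poissonMeasure (ϑ'.toNNReal * δ j)) =
      (Measure.pi fun j => poissonMeasure (ϑ.toNNReal * δ j)).withDensity fun m =>
        ENNReal.ofReal (Real.exp ((∑ j, m j : ℕ) * Real.log (ϑ' / ϑ) - (ϑ' - ϑ) * ∑ j, δ j)) := by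
  refine Measure.ext_of_singleton fun m => ?_
  rw [withDensity_apply _ (measurableSet_singleton m), lintegral_singleton, Measure.pi_singleton,
    Measure.pi_singleton]
  simp_rw [poissonMeasure_singleton_eq_mul hϑ hϑ']
  rw [Finset.prod_mul_distrib, ← ENNReal.ofReal_prod_of_nonneg fun j _ => (Real.exp_pos _).le,
    ← Real.exp_sum, Finset.sum_sub_distrib, ← Finset.sum_mul, ← Finset.mul_sum]
  push_cast
  rfl

end ChangeOfIntensity

section PathLaw

variable {Ω Ω' : Type*} [MeasurableSpace Ω] [MeasurableSpace Ω'] {P : Measure Ω} {P' : Measure Ω'}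
  {ϑ ϑ' T : ℝ} {N : ℝ≥0 → Ω → ℕ} {N' : ℝ≥0 → Ω' → ℕ}

lemma IsPoissonProcess.isProbabilityMeasure (h : IsPoissonProcess P ϑ N) :
    IsProbabilityMeasure P :=
  (h.indep_increments 0 (fun _ => 0) monotone_const).isProbabilityMeasure

lemma IsPoissonProcess.map_eval_grid (h : IsPoissonProcess P ϑ N) {n : ℕ} {t : Fin (n + 1) → ℝ≥0}
    (ht : Monotone t) (h₀ : t 0 = 0) :
    P.map (fun ω i => N (t i) ω) =
      (Measure.pi fun j : Fin n => poissonMeasure (ϑ.toNNReal * (t j.succ - t j.castSucc))).map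
        Fin.partialSum := by
  rw [← h.map_increments ht, Measure.map_map .of_discrete (h.measurable_increments t)]
  refine Measure.map_congr ?_
  filter_upwards [h.ae_eq_partialSum ht h₀] with ω hω
  exact funext hω

lemma IsPoissonProcess.map_eval_grid_eq_withDensity (h : IsPoissonProcess P ϑ N)
    (h' : IsPoissonProcess P' ϑ' N') (hϑ : 0 < ϑ) (hϑ' : 0 < ϑ') {n : ℕ} {t : Fin (n + 1) → ℝ≥0}
    (ht : Monotone t) (h₀ : t 0 = 0) :
    P'.map (fun ω i => N' (t i) ω) = (P.map fun ω i => N (t i) ω).withDensity fun a =>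
      ENNReal.ofReal
        (Real.exp (a (Fin.last n) * Real.log (ϑ' / ϑ) - (ϑ' - ϑ) * t (Fin.last n))) := by
  have hδ : (∑ j : Fin n, (t j.succ - t j.castSucc) : ℝ≥0) = (t (Fin.last n) : ℝ) := by
    rw [NNReal.coe_sum]
    simp_rw [fun j : Fin n => NNReal.coe_sub (ht (Fin.castSucc_lt_succ (i := j)).le)]
    rw [sum_succ_sub_castSucc fun i => (t i : ℝ), h₀, NNReal.coe_zero, sub_zero]
  rw [h.map_eval_grid ht h₀, h'.map_eval_grid ht h₀,
    pi_poissonMeasure_eq_withDensity hϑ hϑ', ← map_withDensity_comp .of_discrete .of_discrete, hδ]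
  congr 2
  ext m
  rw [Function.comp_apply, partialSum_last]

/-- The value at time `T` of a path on `[0, T]`, as a real number; it is `0` when `T < 0`, as there
is no such time. -/
noncomputable def terminal (T : ℝ) (x : {t : ℝ≥0 // (t : ℝ) ≤ T} → ℕ) : ℝ :=
  if h : 0 ≤ T then x ⟨T.toNNReal, (Real.coe_toNNReal T h).le⟩ else 0

lemma terminal_of_nonneg (hT : 0 ≤ T) (x : {t : ℝ≥0 // (t : ℝ) ≤ T} → ℕ) :
    terminal T x = x ⟨T.toNNReal, (Real.coe_toNNReal T hT).le⟩ :=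
  dif_pos hT

lemma measurable_terminal (T : ℝ) : Measurable (terminal T) := by
  unfold terminal
  split_ifs
  · exact Measurable.of_discrete.comp (measurable_pi_apply _)
  · exact measurable_const

lemma measurable_path (hN : ∀ t, Measurable (N t)) (T : ℝ) :
    Measurable fun ω (t : {t : ℝ≥0 // (t : ℝ) ≤ T}) => N t ω :=
  measurable_pi_lambda _ fun _ => hN _

lemma IsPoissonProcess.isProbabilityMeasure_pathLaw (h : IsPoissonProcess P ϑ N) (T : ℝ) :
    IsProbabilityMeasure (pathLaw P N T) :=
  have := h.isProbabilityMeasure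
  Measure.isProbabilityMeasure_map (measurable_path h.measurable T).aemeasurable

lemma exists_monotone_enumeration {α : Type*} [LinearOrder α] {a b : α} (ha : IsBot a)
    (hb : IsTop b) (I : Finset α) :
    ∃ (n : ℕ) (t : Fin (n + 1) → α), Monotone t ∧ t 0 = a ∧ t (Fin.last n) = b ∧
      ∀ i ∈ I, ∃ j, t j = i := by
  set J := insert a (insert b I)
  obtain ⟨n, hn⟩ : ∃ n, J.card = n + 1 :=
    Nat.exists_eq_add_one.2 (Finset.card_pos.2 (Finset.insert_nonempty a _))
  set t := J.orderEmbOfFin hn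
  have hmem {i : α} (hi : i ∈ J) : ∃ j, t j = i := by
    rwa [← Set.mem_range, Finset.range_orderEmbOfFin, Finset.mem_coe]
  obtain ⟨j, hj⟩ := hmem (Finset.mem_insert_self a _)
  obtain ⟨k, hk⟩ := hmem (Finset.mem_insert_of_mem (Finset.mem_insert_self b I))
  refine ⟨n, t, t.monotone, ?_, ?_, fun i hi => hmem ?_⟩
  · exact (hj ▸ t.monotone (Fin.zero_le j)).antisymm (ha _)
  · exact (hb _).antisymm (hk ▸ t.monotone (Fin.le_last k))
  · exact Finset.mem_insert_of_mem (Finset.mem_insert_of_mem hi)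

/-- The log-likelihood ratio of intensity `ϑ'` against intensity `ϑ`, as a function of a path on
`[0, T]`. -/
noncomputable def pathLogLikelihood (ϑ ϑ' T : ℝ) (x : {t : ℝ≥0 // (t : ℝ) ≤ T} → ℕ) : ℝ :=
  terminal T x * Real.log (ϑ' / ϑ) - (ϑ' - ϑ) * T

lemma measurable_pathLogLikelihood (ϑ ϑ' T : ℝ) : Measurable (pathLogLikelihood ϑ ϑ' T) :=
  ((measurable_terminal T).mul_const _).sub_const _

lemma map_eval_pathLaw (hN : ∀ t, Measurable (N t)) {ι : Type*}
    (t : ι → {t : ℝ≥0 // (t : ℝ) ≤ T}) :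
    (pathLaw P N T).map (fun x i => x (t i)) = P.map fun ω i => N (t i) ω :=
  Measure.map_map (by fun_prop) (measurable_path hN T)

lemma IsPoissonProcess.map_eval_pathLaw_eq_withDensity (h : IsPoissonProcess P ϑ N)
    (h' : IsPoissonProcess P' ϑ' N') (hϑ : 0 < ϑ) (hϑ' : 0 < ϑ') (hT : 0 ≤ T) {n : ℕ}
    {t : Fin (n + 1) → {t : ℝ≥0 // (t : ℝ) ≤ T}} (ht : Monotone t) (h₀ : (t 0 : ℝ≥0) = 0)
    (hlast : t (Fin.last n) = ⟨T.toNNReal, (Real.coe_toNNReal T hT).le⟩) :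
    (pathLaw P' N' T).map (fun x i => x (t i)) =
      ((pathLaw P N T).withDensity fun x =>
        ENNReal.ofReal (Real.exp (pathLogLikelihood ϑ ϑ' T x))).map fun x i => x (t i) := by
  have hlik : (fun x => ENNReal.ofReal (Real.exp (pathLogLikelihood ϑ ϑ' T x))) =
      (fun a : Fin (n + 1) → ℕ => ENNReal.ofReal
        (Real.exp (a (Fin.last n) * Real.log (ϑ' / ϑ) - (ϑ' - ϑ) * t (Fin.last n)))) ∘
      fun x i => x (t i) := by
    ext x
    simp only [Function.comp_apply, pathLogLikelihood, terminal_of_nonneg hT, hlast,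
      Real.coe_toNNReal T hT]
  rw [hlik, map_withDensity_comp (by fun_prop) .of_discrete, map_eval_pathLaw h.measurable,
    map_eval_pathLaw h'.measurable]
  exact h.map_eval_grid_eq_withDensity h' hϑ hϑ' (fun _ _ hij => ht hij) h₀

theorem IsPoissonProcess.pathLaw_eq_withDensity (h : IsPoissonProcess P ϑ N)
    (h' : IsPoissonProcess P' ϑ' N') (hϑ : 0 < ϑ) (hϑ' : 0 < ϑ') (hT : 0 ≤ T) :
    pathLaw P' N' T = (pathLaw P N T).withDensity fun x =>
      ENNReal.ofReal (Real.exp (pathLogLikelihood ϑ ϑ' T x)) := by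
  have := h'.isProbabilityMeasure_pathLaw T
  refine IsProjectiveLimit.unique (P := fun I => (pathLaw P' N' T).map I.restrict)
    (fun _ => rfl) fun I => ?_
  obtain ⟨n, t, ht, h₀, hlast, hI⟩ := exists_monotone_enumeration
    (a := (⟨0, hT⟩ : {t : ℝ≥0 // (t : ℝ) ≤ T}))
    (b := ⟨T.toNNReal, (Real.coe_toNNReal T hT).le⟩) (fun t => zero_le (a := t.1))
    (fun t => NNReal.le_toNNReal_of_coe_le t.2) I
  choose! idx hidx using hI
  have hfactor : I.restrict (π := fun _ => ℕ) =
      (fun (a : Fin (n + 1) → ℕ) (i : I) => a (idx i)) ∘ fun x i => x (t i) := by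
    ext x i
    simp only [Function.comp_apply, Finset.restrict, hidx i i.2]
  have hrestrict (μ : Measure ({t : ℝ≥0 // (t : ℝ) ≤ T} → ℕ)) : μ.map I.restrict =
      (μ.map fun x i => x (t i)).map fun a (i : I) => a (idx i) := by
    rw [hfactor, Measure.map_map .of_discrete (by fun_prop)]
  refine (hrestrict _).trans (.trans ?_ (hrestrict _).symm)
  rw [h.map_eval_pathLaw_eq_withDensity h' hϑ hϑ' hT ht (congrArg Subtype.val h₀) hlast]

lemma IsPoissonProcess.rnDeriv_pathLaw (h : IsPoissonProcess P ϑ N)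
    (h' : IsPoissonProcess P' ϑ' N') (hϑ : 0 < ϑ) (hϑ' : 0 < ϑ') (hT : 0 ≤ T) :
    pathLaw P' N' T ≪ pathLaw P N T ∧ ∀ᵐ x ∂pathLaw P N T,
      ((pathLaw P' N' T).rnDeriv (pathLaw P N T) x).toReal =
        Real.exp (pathLogLikelihood ϑ ϑ' T x) := by
  have := h.isProbabilityMeasure_pathLaw T
  rw [h.pathLaw_eq_withDensity h' hϑ hϑ' hT]
  refine ⟨withDensity_absolutelyContinuous _ _, ?_⟩
  filter_upwards [Measure.rnDeriv_withDensity (pathLaw P N T)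
    (measurable_pathLogLikelihood ϑ ϑ' T).exp.ennreal_ofReal] with x hx
  exact hx ▸ ENNReal.toReal_ofReal (Real.exp_pos _).le

lemma IsPoissonProcess.map_terminal (h : IsPoissonProcess P ϑ N) (hT : 0 ≤ T) :
    (pathLaw P N T).map (terminal T) =
      (poissonMeasure (ϑ.toNNReal * T.toNNReal)).map fun n : ℕ => (n : ℝ) := by
  rw [pathLaw, Measure.map_map (measurable_terminal T) (measurable_path h.measurable T),
    ← tsub_zero T.toNNReal, ← h.map_sub zero_le,
    Measure.map_map (f := fun ω => N T.toNNReal ω - N 0 ω) .of_discrete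
      ((h.measurable _).sub (h.measurable _))]
  refine Measure.map_congr ?_
  filter_upwards [h.start_zero] with ω hω
  simp only [Function.comp_apply, terminal_of_nonneg hT, hω, tsub_zero]

end PathLaw

section PathLAN

variable {Ω : Type*} [MeasurableSpace Ω] {P : Measure Ω} {ϑ T : ℝ} {N : ℝ≥0 → Ω → ℕ}

lemma IsPoissonProcess.map_terminal_sub (h : IsPoissonProcess P ϑ N) (hϑ : 0 ≤ ϑ) (hT : 0 ≤ T) :
    (pathLaw P N T).map (fun x => terminal T x - ϑ * T) =
      (poissonMeasure (ϑ.toNNReal * T.toNNReal)).map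
        fun n : ℕ => (n : ℝ) - (ϑ.toNNReal * T.toNNReal : ℝ≥0) := by
  have hsub : Measurable fun y : ℝ => y - ϑ * T := measurable_id.sub_const _
  have hcomp := Measure.map_map (μ := pathLaw P N T) hsub (measurable_terminal T)
  rw [h.map_terminal hT, Measure.map_map hsub .of_discrete] at hcomp
  rw [NNReal.coe_mul, Real.coe_toNNReal ϑ hϑ, Real.coe_toNNReal T hT]
  exact hcomp.symm

lemma IsPoissonProcess.charFun_map_terminal_sub (h : IsPoissonProcess P ϑ N) (hϑ : 0 ≤ ϑ)
    (hT : 0 ≤ T) (s : ℝ) :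
    charFun ((pathLaw P N T).map fun x => terminal T x - ϑ * T) s =
      Complex.exp ((ϑ * T : ℝ) * expRemainder s) := by
  rw [h.map_terminal_sub hϑ hT, charFun_map_sub_poissonMeasure, NNReal.coe_mul,
    Real.coe_toNNReal ϑ hϑ, Real.coe_toNNReal T hT]

lemma IsPoissonProcess.integral_terminal_div_sub_sq (h : IsPoissonProcess P ϑ N) (hϑ : 0 ≤ ϑ)
    (hT : 0 < T) : ∫ x, (terminal T x / T - ϑ) ^ 2 ∂pathLaw P N T = ϑ / T := by
  have hterm : Measurable fun x => terminal T x - ϑ * T := (measurable_terminal T).sub_const _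
  have hsq : ∫ x, (terminal T x - ϑ * T) ^ 2 ∂pathLaw P N T = ϑ * T := by
    rw [← integral_map (f := (· ^ 2)) hterm.aemeasurable (by fun_prop),
      h.map_terminal_sub hϑ hT.le, integral_map .of_discrete (by fun_prop),
      integral_sub_sq_poissonMeasure, NNReal.coe_mul, Real.coe_toNNReal ϑ hϑ,
      Real.coe_toNNReal T hT.le]
  calc ∫ x, (terminal T x / T - ϑ) ^ 2 ∂pathLaw P N T
      = ∫ x, (T ^ 2)⁻¹ * (terminal T x - ϑ * T) ^ 2 ∂pathLaw P N T := by
        congr with x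
        field_simp
    _ = ϑ / T := by
        rw [integral_const_mul, hsq]
        field_simp

lemma IsPoissonProcess.memLp_terminal (h : IsPoissonProcess P ϑ N) (hT : 0 ≤ T) :
    MemLp (terminal T) 2 (pathLaw P N T) := by
  refine MemLp.comp_of_map (g := fun y => y) (f := terminal T) ?_
    (measurable_terminal T).aemeasurable
  rw [h.map_terminal hT, memLp_map_measure_iff (by fun_prop) .of_discrete]
  exact memLp_natCast_poissonMeasure _

lemma IsPoissonProcess.tendsto_charFun_terminal (h : IsPoissonProcess P ϑ N) (hϑ : 0 < ϑ)
    {I : ℝ → ℝ} (hI : ∀ T, 0 < T → 0 < I T) (hIT : Tendsto (fun T => T / I T) atTop (𝓝 ϑ))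
    (s : ℝ) :
    Tendsto (fun T => charFun ((pathLaw P N T).map fun x =>
      (√(I T))⁻¹ * (ϑ⁻¹ * (terminal T x - ϑ * T))) s) atTop
      (𝓝 (Complex.exp (-(s ^ 2 : ℝ) / 2))) := by
  have hs := tendsto_div_sqrt_sq_mul hI hIT s
  have hy : Tendsto (fun T => ϑ⁻¹ * (s / √(I T))) atTop (𝓝 0) := by
    simpa using (tendsto_zero_of_tendsto_sq_mul hs).const_mul ϑ⁻¹
  have hyT : Tendsto (fun T => (ϑ⁻¹ * (s / √(I T))) ^ 2 * (ϑ * T)) atTop (𝓝 (s ^ 2)) := by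
    have hs' := hs.div_const ϑ
    rw [mul_div_cancel_right₀ _ hϑ.ne'] at hs'
    refine hs'.congr fun T => ?_
    field_simp
  refine ((Complex.continuous_exp.tendsto _).comp (tendsto_mul_expRemainder hy hyT)).congr' ?_
  filter_upwards [eventually_gt_atTop 0] with T hT
  have hterm : Measurable fun x => terminal T x - ϑ * T := (measurable_terminal T).sub_const _
  rw [charFun_map_mul_comp (hterm.const_mul _).aemeasurable,
    charFun_map_mul_comp hterm.aemeasurable, h.charFun_map_terminal_sub hϑ.le hT.le,
    ← div_eq_inv_mul s]
  rfl

theorem isLAN_pathLaw {Θ : Set ℝ} {P : ℝ → Measure Ω} {N : ℝ → ℝ≥0 → Ω → ℕ}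
    (hΘ : Θ ⊆ Set.Ioi 0) (h : ∀ ϑ ∈ Θ, IsPoissonProcess (P ϑ) ϑ (N ϑ)) (hϑΘ : ϑ ∈ Θ) :
    IsLAN (fun T ϑ' => pathLaw (P ϑ') (N ϑ') T) Θ ϑ (fun T => T / ϑ) := by
  have hϑ : 0 < ϑ := hΘ hϑΘ
  have hN := h ϑ hϑΘ
  have hI : ∀ T, 0 < T → 0 < T / ϑ := fun T hT => div_pos hT hϑ
  have hIT : Tendsto (fun T => T / (T / ϑ)) atTop (𝓝 ϑ) :=
    tendsto_const_nhds.congr' <| (eventually_gt_atTop 0).mono fun T hT => by field_simp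
  have hQ (T : ℝ) := hN.isProbabilityMeasure_pathLaw T
  have hS (T : ℝ) : Measurable fun x => ϑ⁻¹ * (terminal T x - ϑ * T) :=
    ((measurable_terminal T).sub_const _).const_mul _
  refine isLAN_of_abs_sub_le (S := fun T x => ϑ⁻¹ * (terminal T x - ϑ * T)) (A := terminal)
    (ℓ := fun T ϑ' => pathLogLikelihood ϑ ϑ' T) (η := 0) hϑ hI hIT hQ hS
    (fun T ϑ' => measurable_pathLogLikelihood ϑ ϑ' T)
    (tendstoInDistribution_gaussianReal (fun T => (hS T).const_mul _)
      (hN.tendsto_charFun_terminal hϑ hI hIT))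
    (fun T hT ϑ' hϑ' => hN.rnDeriv_pathLaw (h ϑ' hϑ') hϑ (hΘ hϑ') hT.le) ?_ tendsto_const_nhds
    ((eventually_ge_atTop 0).mono fun T hT => hN.memLp_terminal hT) ?_
  · refine .of_forall fun T u _ x => (abs_eq_zero.2 ?_).trans_le (by simp)
    rw [pathLogLikelihood, add_div, div_self hϑ.ne']
    field_simp
    ring
  · refine ((tendsto_const_nhds (x := ϑ)).div_atTop tendsto_id).congr' ?_
    filter_upwards [eventually_gt_atTop 0] with T hT
    exact (hN.integral_terminal_div_sub_sq hϑ.le hT).symm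

end PathLAN

end AcrossScales

theorem theorem2 {Ω : Type*} [MeasurableSpace Ω]
    (Θ : Set ℝ) (hΘ_pos : Θ ⊆ Set.Ioi 0) (hΘ_int : (interior Θ).Nonempty)
    (P : ℝ → Measure Ω) (N : ℝ → ℝ≥0 → Ω → ℕ) (ε : ℝ → ℕ → Ω → ℤ)
    (hmodel : ∀ ϑ ∈ Θ, AcrossScales.IsModel (P ϑ) ϑ (N ϑ) (ε ϑ))
    (Δ : ℝ → ℝ) (hΔ : ∀ T, 0 < T → 0 < Δ T ∧ Δ T ≤ T)
    (hmicro : Tendsto Δ atTop (𝓝 0)) :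
    ∀ ϑ ∈ Θ,
      AcrossScales.IsLAN
        (fun T ϑ' => AcrossScales.observationLaw (P ϑ')
          (AcrossScales.compound (N ϑ') (ε ϑ')) T (Δ T))
        Θ ϑ
        (fun T => AcrossScales.information (P ϑ)
          (AcrossScales.compound (N ϑ) (ε ϑ)) ϑ T (Δ T)) ∧
      ((fun T => AcrossScales.information (P ϑ)
          (AcrossScales.compound (N ϑ) (ε ϑ)) ϑ T (Δ T)) ~[atTop] fun T => T / ϑ) ∧
      (∀ T, 0 < T →
        Tendsto (fun δ => AcrossScales.information (P ϑ)
          (AcrossScales.compound (N ϑ) (ε ϑ)) ϑ T δ) (𝓝[>] 0) (𝓝 (T / ϑ))) ∧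
      AcrossScales.IsLAN (fun T ϑ' => AcrossScales.pathLaw (P ϑ') (N ϑ') T)
        Θ ϑ (fun T => T / ϑ) := by
  intro ϑ hϑΘ
  have hϑ : 0 < ϑ := hΘ_pos hϑΘ
  have hM := hmodel ϑ hϑΘ
  have hΔ' : ∀ T, 0 < T → 0 < Δ T := fun T hT => (hΔ T hT).1
  have hD : Tendsto Δ atTop (𝓝[>] 0) := AcrossScales.tendsto_nhdsGT_zero_of_pos hΔ' hmicro
  exact ⟨AcrossScales.isLAN_observationLaw hΘ_pos hmodel hΔ' hmicro hϑΘ,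
    hM.isEquivalent_information hϑ hD, fun T _ => hM.tendsto_information hϑ tendsto_id T,
    AcrossScales.isLAN_pathLaw hΘ_pos (fun ϑ' h => (hmodel ϑ' h).poisson) hϑΘ⟩
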